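/- Conventions. For a sequence $M=(M_p)_{p\ge 0}$ of positive reals put $\mu_0:=1$ and $\mu_p:=M_p/M_{p-1}$ for $p\ge 1$; similarly $\nu_p$ for $N$. Let $\mathcal{LC}$ be the set of positive sequences with $1=M_0\le M_1$, $M_j^2\le M_{j-1}M_{j+1}$ for all $j\ge 1$, and $\lim_{k\to\infty}(M_k)^{1/k}=\infty$. Write $M\preceq N$ if there are $C_1,C_2\ge 1$ with $M_p\le C_1C_2^pN_p$ for all $p\ge 0$. The Roumieu sequence space is $\Lambda_{\{M\}}:=\{(a_p)_p\in\mathbb{C}^{\mathbb{N}}:\ \exists h>0:\ \sup_{p}\frac{|a_p|}{h^pM_p}<\infty\}$, and the Beurling space $\Lambda_{(M)}$ is defined in the same way with "$\exists h>0$" replaced by "$\forall h>0$". Let $r\ge 1$ be an integer. For an interval $S\in\{\mathbb{R},[0,\infty),[0,1]\}$ let $\mathcal{R}_{r,\{M\}}(S)$ be the set of all smooth $f:S\to\mathbb{C}$ (with one-sided derivatives at end points of $S$) such that $f^{(rn+j)}(0)=0$ for all $n\ge 0$ and $1\le j\le r-1$, and $\sup_{n\in\mathbb{N},\,x\in S}\frac{|f^{(rn)}(x)|}{h^nM_n}<\infty$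 for some $h>0$; let $\mathcal{R}_{r,(M)}(S)$ be the analogous set with "for all $h>0$". Writing $[M]$ for either $\{M\}$ or $(M)$, put $$\mathcal{D}_{r,[M]}([-1,1]):=\{f\in\mathcal{R}_{r,[M]}(\mathbb{R}):\operatorname{supp} f\subseteq[-1,1]\},\qquad \mathcal{L}_{r,[M]}:=\{f\in\mathcal{R}_{r,[M]}([0,\infty)):\operatorname{supp} f\subseteq[0,1]\},$$ $$\mathcal{N}_{r,[M]}:=\mathcal{R}_{r,[M]}([0,\infty)),\qquad \mathcal{E}_{r,[M]}:=\mathcal{R}_{r,[M]}([0,1]).$$ For integers $p,s\ge 1$ put $\lambda^{M,N}_{p,s}:=\sup_{0\le j<p}\left(\frac{M_p}{s^pN_j}\right)^{1/(p-j)}$. The condition $(M,N)_{SV_r}$ means: there is an integer $s\ge 1$ such that $$\sup_{p\ge 1}\frac{(\lambda^{M,N}_{p,s})^{1/r}}{p}\sum_{k\ge p}\left(\frac{1}{\nu_k}\right)^{1/r}<\infty .$$ Theorem. Let $r\ge 1$ be an integer and let $M,N\in\mathcal{LC}$ with $M\preceq N$. In the Roumieu case ($[\cdot]=\{\cdot\}$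 throughout) assume $\liminf_{p\to\infty}\left(\frac{(M_p)^{1/r}}{p!}\right)^{1/p}>0$; in the Beurling case ($[\cdot]=(\cdot)$ throughout) assume $\lim_{p\to\infty}\left(\frac{(M_p)^{1/r}}{p!}\right)^{1/p}=\infty$. Then, in either case, for each one of the four spaces $\mathcal{A}\in\{\mathcal{D}_{r,[N]}([-1,1]),\ \mathcal{L}_{r,[N]},\ \mathcal{N}_{r,[N]},\ \mathcal{E}_{r,[N]}\}$ the following are equivalent: (i) $\Lambda_{[M]}\subseteq\{(f^{(rj)}(0))_{j\in\mathbb{N}}: f\in\mathcal{A}\}$; (ii) $(M,N)_{SV_r}$ holds. -/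

import Mathlib

open Filter Set
open scoped ContDiff Topology

noncomputable section

namespace RamifiedBorel

/-- The two types of ultradifferentiable classes: `{M}` (Roumieu) and `(M)` (Beurling). -/
inductive UltraType where
  | roumieu
  | beurling

/-- "There is `h > 0`" in the Roumieu case, "for all `h > 0`" in the Beurling case. -/
def UltraType.Quant : UltraType → (ℝ → Prop) → Prop
  | .roumieu, P => ∃ h : ℝ, 0 < h ∧ P h
  | .beurling, P => ∀ h : ℝ, 0 < h → P h

/-- The quotients `μ_0 = 1`, `μ_p = M_p / M_{p-1}` for `p ≥ 1`. -/
def quot (M : ℕ → ℝ) : ℕ → ℝ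
  | 0 => 1
  | p + 1 => M (p + 1) / M p

/-- The set `LC` of positive, normalized, log-convex sequences with `(M_k)^{1/k} → ∞`. -/
structure IsLC (M : ℕ → ℝ) : Prop where
  pos : ∀ p, 0 < M p
  zero_eq_one : M 0 = 1
  one_le : 1 ≤ M 1
  logConvex : ∀ j, M (j + 1) ^ 2 ≤ M j * M (j + 2)
  tendsto_root : Tendsto (fun k : ℕ => M k ^ (1 / (k : ℝ))) atTop atTop

/-- The relation `M ≼ N`. -/
def Preceq (M N : ℕ → ℝ) : Prop :=
  ∃ C₁ C₂ : ℝ, 1 ≤ C₁ ∧ 1 ≤ C₂ ∧ ∀ p, M p ≤ C₁ * C₂ ^ p * N p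

/-- The terms `((M_p)^{1/r} / p!)^{1/p}`. -/
def rootQuot (r : ℕ) (M : ℕ → ℝ) (p : ℕ) : ℝ :=
  (M p ^ (1 / (r : ℝ)) / (p.factorial : ℝ)) ^ (1 / (p : ℝ))

/-- Roumieu case: `liminf ((M_p)^{1/r} / p!)^{1/p} > 0` (the lower limit is taken in `[0, ∞]`).
Beurling case: `lim ((M_p)^{1/r} / p!)^{1/p} = ∞`. -/
def GrowthCondition : UltraType → ℕ → (ℕ → ℝ) → Prop
  | .roumieu, r, M => 0 < liminf (fun p => ENNReal.ofReal (rootQuot r M p)) atTop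
  | .beurling, r, M => Tendsto (rootQuot r M) atTop atTop

/-- `λ_{p,s}^{M,N} = sup_{0 ≤ j < p} (M_p / (s^p N_j))^{1/(p-j)}`, a maximum of finitely many
numbers when `p ≥ 1`. -/
def lam (M N : ℕ → ℝ) (p s : ℕ) : ℝ :=
  ⨆ j : Fin p, (M p / ((s : ℝ) ^ p * N j)) ^ (1 / ((p : ℝ) - (j : ℝ)))

/-- The condition `(M,N)_{SV_r}`: there is an integer `s ≥ 1` such that the supremum over `p ≥ 1`
of `(λ_{p,s})^{1/r} / p * ∑_{k ≥ p} (1/ν_k)^{1/r}` is finite. In particular the series converge. -/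
def SV (r : ℕ) (M N : ℕ → ℝ) : Prop :=
  ∃ s : ℕ, 1 ≤ s ∧ ∃ C : ℝ, ∀ p : ℕ, 1 ≤ p →
    Summable (fun k : ℕ => (1 / quot N (p + k)) ^ (1 / (r : ℝ))) ∧
    lam M N p s ^ (1 / (r : ℝ)) / (p : ℝ) *
      ∑' k : ℕ, (1 / quot N (p + k)) ^ (1 / (r : ℝ)) ≤ C

/-- The sequence space `Λ_{[M]}`. -/
def seqSpace (t : UltraType) (M : ℕ → ℝ) : Set (ℕ → ℂ) :=
  {a | t.Quant fun h => BddAbove (range fun p : ℕ => ‖a p‖ / (h ^ p * M p))}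

/-- The `r`-ramification class on an interval `S ∋ 0` (the line, or a closed interval, with
one-sided derivatives at its end points): `f` is smooth on `S`, `f^{(rn+j)}(0) = 0` for all `n` and
`1 ≤ j ≤ r - 1`, and `|f^{(rn)}(x)| / (h^n M_n)` is bounded over `n` and `x ∈ S` for some
(resp. every) `h > 0`. A function on `S` is represented by any function on `ℝ` that extends it;
the conditions only involve its values on `S`. -/
def ramClass (t : UltraType) (r : ℕ) (M : ℕ → ℝ) (S : Set ℝ) : Set (ℝ → ℂ) :=
  {f | ContDiffOn ℝ ∞ f S ∧
    (∀ n j : ℕ, 1 ≤ j → j < r → iteratedDerivWithin (r * n + j) f S 0 = 0) ∧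
    t.Quant fun h => BddAbove
      (range fun q : ℕ × S =>
        ‖iteratedDerivWithin (r * q.1) f S (q.2 : ℝ)‖ / (h ^ q.1 * M q.1))}

/-- `D_{r,[M]}([-a,a])`. -/
def spaceD (t : UltraType) (r : ℕ) (M : ℕ → ℝ) (a : ℝ) : Set (ℝ → ℂ) :=
  {f | f ∈ ramClass t r M univ ∧ tsupport f ⊆ Icc (-a) a}

/-- `L_{r,[M]}`: functions on `[0, ∞)` with support in `[0,1]`. -/
def spaceL (t : UltraType) (r : ℕ) (M : ℕ → ℝ) : Set (ℝ → ℂ) :=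
  {f | f ∈ ramClass t r M (Ici 0) ∧ closure (Function.support f ∩ Ici 0) ⊆ Icc 0 1}

/-- `N_{r,[M]}`: functions on `[0, ∞)`. -/
def spaceN (t : UltraType) (r : ℕ) (M : ℕ → ℝ) : Set (ℝ → ℂ) :=
  ramClass t r M (Ici 0)

/-- `E_{r,[M]}`: functions on `[0, 1]`. -/
def spaceE (t : UltraType) (r : ℕ) (M : ℕ → ℝ) : Set (ℝ → ℂ) :=
  ramClass t r M (Icc 0 1)

/-- The ramified Borel map `f ↦ (f^{(rj)}(0))_j` for functions on `S`. -/
def borelMap (r : ℕ) (S : Set ℝ) (f : ℝ → ℂ) : ℕ → ℂ :=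
  fun j => iteratedDerivWithin (r * j) f S 0

end RamifiedBorel

end

/-! Restriction sends the images of the Borel map one into the next in the order D, L, N, E. It
therefore suffices to build extensions in the smallest space D and to deduce `SV` from surjectivity
onto `seqSpace` in the largest space E.

Throughout, `interp` spreads N over all orders of differentiation: each ν is replaced by r equal
factors ν^{1/r}, so derivatives of order not divisible by r also have a natural weight.

Sufficiency. For each p a block is made, equal to x^{rp}/(rp)! near 0 and cut off inside [-1,1]
(`exists_block`). The cut-off is an infinite iterated average whose windows are governed by ρ_p =
λ_{p,s}^{1/r} up to order rp and by the quotients of `interp` afterwards. `SV` says that the windows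
add up to O(p/ρ_p); on a support of that size the monomial costs only a factor e^{O(p)}. The
definition of λ turns the resulting powers of ρ_p into M_p ≤ K A^p ρ_p^{r(p-n)} N_n. The growth
condition bounds p/ρ_p (Roumieu) or makes it tend to 0 (Beurling), so the support condition can be
met, and the blocks are summed with the prescribed coefficients (`BlockData.exists_extension`).

Necessity. Baire's theorem on a product of discs gives constants, uniform in large p, with which the
jet having a single entry T_p at order rp is approximated by jets of functions on [0,1]
(`exists_approxJet_of_realizes`). Such a function minus T_p x^{rp}/(rp)! is almost flat at 0, and
Bang's estimate (`IsTower.bang`) keeps it small up to a distance given by a partial sum of the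
inverse quotients. At the distance where the monomial first outgrows the class bounds it cannot be
small; hence the partial sums are bounded by that distance (`ApproxJet.sum_pow_mul_le`), which is
`SV` after taking roots (`SV_of_approxJet`). -/

namespace RamifiedBorel

/-! ### Weight sequences -/

namespace IsLC

variable {N : ℕ → ℝ}

lemma quot_pos (hN : IsLC N) (k : ℕ) : 0 < quot N k := by
  cases k with
  | zero => exact one_pos
  | succ p => exact div_pos (hN.pos _) (hN.pos _)

lemma mul_quot (hN : IsLC N) (p : ℕ) : N p * quot N (p + 1) = N (p + 1) := by
  have := (hN.pos p).ne'
  simp only [quot]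
  field_simp

lemma quot_mono (hN : IsLC N) : Monotone (quot N) := by
  refine monotone_nat_of_le_succ fun k => ?_
  cases k with
  | zero => simpa [quot, hN.zero_eq_one] using hN.one_le
  | succ p =>
    simp only [quot]
    rw [div_le_div_iff₀ (hN.pos _) (hN.pos _)]
    nlinarith [hN.logConvex p]

lemma one_le_quot (hN : IsLC N) (k : ℕ) : 1 ≤ quot N k := hN.quot_mono (Nat.zero_le k)

lemma mono (hN : IsLC N) : Monotone N := by
  refine monotone_nat_of_le_succ fun k => ?_
  rw [← hN.mul_quot k]
  exact le_mul_of_one_le_right (hN.pos k).le (hN.one_le_quot _)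

lemma apply_add_le (hN : IsLC N) (j i : ℕ) : N (j + i) ≤ N j * quot N (j + i) ^ i := by
  induction i with
  | zero => simp
  | succ i ih =>
    rw [← add_assoc, ← hN.mul_quot (j + i), pow_succ, ← mul_assoc]
    refine mul_le_mul_of_nonneg_right (ih.trans ?_) (hN.quot_pos _).le
    exact mul_le_mul_of_nonneg_left
      (pow_le_pow_left₀ (hN.quot_pos _).le (hN.quot_mono (Nat.le_succ _)) _) (hN.pos _).le

end IsLC

/-- The quotients of the interpolating sequence: each `(ν_{k+1})^{1/r}` is repeated `r` times. -/
noncomputable def step (r : ℕ) (N : ℕ → ℝ) (l : ℕ) : ℝ := quot N (l / r + 1) ^ (1 / (r : ℝ))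

/-- The log-convex sequence whose value at `r * n` is `N n`. -/
noncomputable def interp (r : ℕ) (N : ℕ → ℝ) (m : ℕ) : ℝ := ∏ l ∈ Finset.range m, step r N l

section Interp

variable {r : ℕ} {N : ℕ → ℝ}

lemma one_le_step (hN : IsLC N) (l : ℕ) : 1 ≤ step r N l :=
  Real.one_le_rpow (hN.one_le_quot _) (by positivity)

lemma step_pos (hN : IsLC N) (l : ℕ) : 0 < step r N l := one_pos.trans_le (one_le_step hN l)

lemma step_mono (hN : IsLC N) : Monotone (step r N) := fun a b h =>
  Real.rpow_le_rpow (hN.quot_pos _).le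
    (hN.quot_mono (Nat.succ_le_succ (Nat.div_le_div_right h))) (by positivity)

lemma rpow_one_div_pow {x : ℝ} (hx : 0 ≤ x) (hr : 1 ≤ r) : (x ^ (1 / (r : ℝ))) ^ r = x := by
  rw [one_div, Real.rpow_inv_natCast_pow hx (by omega)]

lemma step_pow (hr : 1 ≤ r) (hN : IsLC N) (l : ℕ) : step r N l ^ r = quot N (l / r + 1) :=
  rpow_one_div_pow (hN.quot_pos _).le hr

lemma step_mul_add {i : ℕ} (hi : i < r) (n : ℕ) :
    step r N (r * n + i) = step r N (r * n) := by
  simp only [step, Nat.mul_add_div (by omega : r > 0), Nat.div_eq_of_lt hi,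
    Nat.mul_div_cancel_left n (by omega : 0 < r), add_zero]

lemma interp_succ (m : ℕ) : interp r N (m + 1) = interp r N m * step r N m :=
  Finset.prod_range_succ _ _

lemma interp_add (m j : ℕ) :
    interp r N (m + j) = interp r N m * ∏ l ∈ Finset.range j, step r N (m + l) :=
  Finset.prod_range_add _ _ _

lemma interp_pos (hN : IsLC N) (m : ℕ) : 0 < interp r N m :=
  Finset.prod_pos fun l _ => step_pos hN l

lemma interp_mono (hN : IsLC N) : Monotone (interp r N) :=
  monotone_nat_of_le_succ fun m => by
    rw [interp_succ]
    exact le_mul_of_one_le_right (interp_pos hN m).le (one_le_step hN m)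

lemma one_le_interp (hN : IsLC N) (m : ℕ) : 1 ≤ interp r N m := by
  have := interp_mono (r := r) hN (Nat.zero_le m)
  simpa [interp] using this

lemma interp_add_of_le (n : ℕ) {j : ℕ} (hj : j ≤ r) :
    interp r N (r * n + j) = interp r N (r * n) * step r N (r * n) ^ j := by
  rw [interp_add, Finset.prod_congr rfl fun l hl =>
    step_mul_add ((Finset.mem_range.1 hl).trans_le hj) n]
  simp

lemma interp_mul (hr : 1 ≤ r) (hN : IsLC N) (n : ℕ) : interp r N (r * n) = N n := by
  induction n with
  | zero => simp [interp, hN.zero_eq_one]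
  | succ n ih =>
    rw [Nat.mul_succ, interp_add_of_le n le_rfl, step_pow hr hN,
      Nat.mul_div_cancel_left n (by omega), ih, hN.mul_quot]

/-- All i quotients between orders m and m + i have index at most l, and the quotients increase.
This is where log-convexity enters Bang's estimate. -/
lemma interp_add_le (hN : IsLC N) {m i l : ℕ} (h : m + i ≤ l + 1) :
    interp r N (m + i) ≤ interp r N m * step r N l ^ i := by
  rw [interp_add]
  refine mul_le_mul_of_nonneg_left ?_ (interp_pos hN m).le
  rw [← Finset.card_range i, ← Finset.prod_const, Finset.card_range]
  refine Finset.prod_le_prod (fun _ _ => (step_pos hN _).le) fun k hk => step_mono hN ?_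
  have := Finset.mem_range.1 hk
  omega

end Interp

/-! ### Smooth series -/

lemma contDiff_tsum_hasSum_iteratedDeriv {f : ℕ → ℝ → ℂ} (hf : ∀ i, ContDiff ℝ ∞ (f i))
    {v : ℕ → ℕ → ℝ} (hv : ∀ k, Summable (v k))
    (h : ∀ k i x, ‖iteratedDeriv k (f i) x‖ ≤ v k i) :
    ContDiff ℝ ∞ (fun x => ∑' i, f i x) ∧ ∀ k x, HasSum (fun i => iteratedDeriv k (f i) x)
      (iteratedDeriv k (fun x => ∑' i, f i x) x) := by
  have h' : ∀ (k i : ℕ) (x : ℝ), (k : ℕ∞) ≤ ⊤ → ‖iteratedFDeriv ℝ k (f i) x‖ ≤ v k i := by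
    intro k i x _
    rw [norm_iteratedFDeriv_eq_norm_iteratedDeriv]
    exact h k i x
  refine ⟨contDiff_tsum (N := ⊤) hf (fun k _ => hv k) h', fun k x => ?_⟩
  have hs : Summable fun i => iteratedFDeriv ℝ k (f i) x :=
    Summable.of_norm_bounded (hv k) fun i => h' k i x le_top
  have := ContinuousMultilinearMap.hasSum_eval hs.hasSum (fun _ => (1 : ℝ))
  simp only [iteratedDeriv_eq_iteratedFDeriv]
  rw [iteratedFDeriv_tsum (N := ⊤) hf (fun k _ => hv k) h' le_top]
  exact this

/-! ### Averages and cut-off functions -/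

/-- The mean value of `f` on `[x - a, x + a]`. -/
noncomputable def avg (a : ℝ) (f : ℝ → ℂ) (x : ℝ) : ℂ :=
  (2 * a)⁻¹ • ∫ t in (x - a)..(x + a), f t

section Avg

variable {a : ℝ} {f : ℝ → ℂ}

lemma hasDerivAt_avg (hf : Continuous f) (x : ℝ) :
    HasDerivAt (avg a f) ((2 * a)⁻¹ • (f (x + a) - f (x - a))) x := by
  have hi : ∀ c d : ℝ, IntervalIntegrable f MeasureTheory.volume c d :=
    fun c d => hf.intervalIntegrable c d
  have h1 : avg a f = fun x => (2 * a)⁻¹ • ((∫ t in (0 : ℝ)..(x + a), f t) -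
      ∫ t in (0 : ℝ)..(x - a), f t) := by
    funext y
    rw [avg, intervalIntegral.integral_interval_sub_left (hi _ _) (hi _ _)]
  have h2 : ∀ y, HasDerivAt (fun u => ∫ t in (0 : ℝ)..u, f t) (f y) y :=
    fun y => (hf.integral_hasStrictDerivAt 0 y).hasDerivAt
  rw [h1]
  exact (((h2 _).comp_add_const x a).sub ((h2 _).comp_sub_const x a)).const_smul ((2 * a)⁻¹)

lemma deriv_avg (hf : ContDiff ℝ ∞ f) : deriv (avg a f) = avg a (deriv f) := by
  funext x
  rw [(hasDerivAt_avg hf.continuous x).deriv, avg,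
    intervalIntegral.integral_deriv_eq_sub (fun y _ => (hf.differentiable (by simp)) y)]
  exact ((contDiff_infty_iff_deriv.1 hf).2.continuous).intervalIntegrable _ _

lemma contDiff_avg (hf : ContDiff ℝ ∞ f) : ContDiff ℝ ∞ (avg a f) := by
  refine contDiff_infty_iff_deriv.2
    ⟨fun x => (hasDerivAt_avg hf.continuous x).differentiableAt, ?_⟩
  have : deriv (avg a f) = fun x => (2 * a)⁻¹ • (f (x + a) - f (x - a)) :=
    funext fun x => (hasDerivAt_avg hf.continuous x).deriv
  rw [this]
  exact ((hf.comp (contDiff_id.add contDiff_const)).sub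
    (hf.comp (contDiff_id.sub contDiff_const))).const_smul _

lemma iteratedDeriv_avg (hf : ContDiff ℝ ∞ f) (m : ℕ) :
    iteratedDeriv m (avg a f) = avg a (iteratedDeriv m f) := by
  induction m generalizing f with
  | zero => simp
  | succ m ih =>
    rw [iteratedDeriv_succ', iteratedDeriv_succ', deriv_avg hf,
      ih (contDiff_infty_iff_deriv.1 hf).2]

/-- Averaging fixes constants, so the difference is the average of f - c. The choices c = 0, C = 0
and c = f x yield boundedness, local constancy and closeness to f. -/
lemma norm_avg_sub_le {C : ℝ} {c : ℂ} (ha : 0 < a) (hf : Continuous f) {x : ℝ}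
    (h : ∀ y ∈ Icc (x - a) (x + a), ‖f y - c‖ ≤ C) : ‖avg a f x - c‖ ≤ C := by
  have hi : IntervalIntegrable f MeasureTheory.volume (x - a) (x + a) := hf.intervalIntegrable _ _
  have hax : x - a ≤ x + a := by linarith
  have h1 : avg a f x - c = (2 * a)⁻¹ • ∫ t in (x - a)..(x + a), (f t - c) := by
    rw [intervalIntegral.integral_sub hi (by simp), intervalIntegral.integral_const, smul_sub,
      smul_smul, avg]
    have : (2 * a)⁻¹ * (x + a - (x - a)) = 1 := by field_simp; ring
    rw [this, one_smul]
  have h2 := intervalIntegral.norm_integral_le_of_norm_le_const (a := x - a) (b := x + a)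
    (C := C) (f := fun t => f t - c) fun y hy => h y (by
      rw [uIoc_of_le hax] at hy; exact ⟨hy.1.le, hy.2⟩)
  rw [h1, norm_smul, norm_inv, Real.norm_of_nonneg (by positivity : 0 ≤ 2 * a)]
  rw [show |x + a - (x - a)| = 2 * a by rw [abs_of_pos] <;> linarith] at h2
  rw [inv_mul_le_iff₀ (by positivity)]
  linarith

lemma norm_avg_le {C : ℝ} (ha : 0 < a) (hf : Continuous f) (h : ∀ y, ‖f y‖ ≤ C) (x : ℝ) :
    ‖avg a f x‖ ≤ C := by
  simpa using norm_avg_sub_le (c := 0) ha hf (x := x) (C := C) fun y _ => by simpa using h y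

lemma avg_eq_of_eqOn {c : ℂ} (ha : 0 < a) (hf : Continuous f) {x : ℝ}
    (h : ∀ y ∈ Icc (x - a) (x + a), f y = c) : avg a f x = c := by
  have := norm_avg_sub_le (c := c) ha hf (x := x) (C := 0) fun y hy => by simp [h y hy]
  exact sub_eq_zero.1 (norm_le_zero_iff.1 this)

lemma norm_avg_sub_self_le {C : ℝ} (ha : 0 < a) (hf : ContDiff ℝ ∞ f)
    (h : ∀ y, ‖deriv f y‖ ≤ C) (x : ℝ) : ‖avg a f x - f x‖ ≤ C * a := by
  refine norm_avg_sub_le ha hf.continuous fun y hy => ?_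
  have hC : 0 ≤ C := (norm_nonneg _).trans (h 0)
  refine (convex_univ.norm_image_sub_le_of_norm_deriv_le
    (fun z _ => (hf.differentiable (by simp)) z) (fun z _ => h z) (mem_univ x)
    (mem_univ y)).trans ?_
  refine mul_le_mul_of_nonneg_left ?_ hC
  rw [Real.norm_eq_abs, abs_le]
  constructor <;> linarith [hy.1, hy.2]

lemma norm_deriv_avg_le {C : ℝ} (ha : 0 < a) (hf : Continuous f) (h : ∀ y, ‖f y‖ ≤ C) (x : ℝ) :
    ‖deriv (avg a f) x‖ ≤ C * a⁻¹ := by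
  rw [(hasDerivAt_avg hf x).deriv, norm_smul, norm_inv,
    Real.norm_of_nonneg (by positivity : 0 ≤ 2 * a)]
  have : ‖f (x + a) - f (x - a)‖ ≤ 2 * C :=
    (norm_sub_le _ _).trans (by linarith [h (x + a), h (x - a)])
  calc (2 * a)⁻¹ * ‖f (x + a) - f (x - a)‖ ≤ (2 * a)⁻¹ * (2 * C) := by gcongr
    _ = C * a⁻¹ := by field_simp

end Avg

/-- Successive averages of `f` over windows of half-widths `w 0, w 1, …`. -/
noncomputable def iterAvg (w : ℕ → ℝ) (f : ℝ → ℂ) : ℕ → ℝ → ℂ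
  | 0 => f
  | m + 1 => avg (w m) (iterAvg w f m)

section IterAvg

variable {w : ℕ → ℝ} {f : ℝ → ℂ}

lemma contDiff_iterAvg (hf : ContDiff ℝ ∞ f) (m : ℕ) : ContDiff ℝ ∞ (iterAvg w f m) := by
  induction m with
  | zero => exact hf
  | succ m ih => exact contDiff_avg ih

lemma norm_iteratedDeriv_iterAvg_le_of_base (hw : ∀ l, 0 < w l) (hf : ContDiff ℝ ∞ f) {k : ℕ}
    {C : ℝ} (h : ∀ x, ‖iteratedDeriv k f x‖ ≤ C) (m : ℕ) (x : ℝ) :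
    ‖iteratedDeriv k (iterAvg w f m) x‖ ≤ C := by
  induction m generalizing x with
  | zero => exact h x
  | succ m ih =>
    rw [iterAvg, iteratedDeriv_avg (contDiff_iterAvg hf m)]
    exact norm_avg_le (hw m) ((contDiff_iterAvg hf m).continuous_iteratedDeriv k
      (by exact_mod_cast le_top)) ih x

/-- Each of the first k averages absorbs one derivative at the price of its inverse half-width; the
later ones do not increase the supremum. The bound is therefore independent of m and survives the
limit. -/
lemma norm_iteratedDeriv_iterAvg_le (hw : ∀ l, 0 < w l) (hf : ContDiff ℝ ∞ f)
    (h : ∀ x, ‖f x‖ ≤ 1) {k m : ℕ} (hk : k ≤ m) (x : ℝ) :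
    ‖iteratedDeriv k (iterAvg w f m) x‖ ≤ ∏ l ∈ Finset.range k, (w l)⁻¹ := by
  induction m generalizing k x with
  | zero =>
    obtain rfl : k = 0 := by omega
    simpa [iterAvg] using h x
  | succ m ih =>
    have hc := contDiff_iterAvg (w := w) hf m
    rcases hk.lt_or_eq with hlt | rfl
    · rw [iterAvg, iteratedDeriv_avg hc]
      exact norm_avg_le (hw m) (hc.continuous_iteratedDeriv k (by exact_mod_cast le_top))
        (fun y => ih (by omega) y) x
    · rw [iterAvg, iteratedDeriv_succ, iteratedDeriv_avg hc, Finset.prod_range_succ]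
      exact norm_deriv_avg_le (hw m) (hc.continuous_iteratedDeriv m (by exact_mod_cast le_top))
        (fun y => ih le_rfl y) x

lemma iterAvg_eq_of_eqOn (hw : ∀ l, 0 < w l) (hf : ContDiff ℝ ∞ f) {c : ℂ} (m : ℕ) {x : ℝ}
    (h : ∀ y, |y - x| ≤ ∑ l ∈ Finset.range m, w l → f y = c) : iterAvg w f m x = c := by
  induction m generalizing x with
  | zero => exact h x (by simp)
  | succ m ih =>
    refine avg_eq_of_eqOn (hw m) (contDiff_iterAvg hf m).continuous fun y hy => ih fun z hz => ?_
    refine h z ?_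
    rw [Finset.sum_range_succ]
    have := abs_sub_le z y x
    have h2 : |y - x| ≤ w m := by rw [abs_le]; constructor <;> linarith [hy.1, hy.2]
    linarith

end IterAvg

/-- The function is the limit of iterated averages of a fixed bump, written as a telescoping series.
Summability of the windows gives convergence of all derivatives and limits the spreading of the
support. -/
theorem exists_cutoff {w : ℕ → ℝ} (hw : ∀ l, 0 < w l) (hs : Summable w) :
    ∃ χ : ℝ → ℂ, ContDiff ℝ ∞ χ ∧ (χ =ᶠ[𝓝 0] fun _ => 1) ∧
      (∀ x, 4 * ∑' l, w l ≤ |x| → χ x = 0) ∧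
      ∀ m x, ‖iteratedDeriv m χ x‖ ≤ ∏ l ∈ Finset.range m, (w l)⁻¹ := by
  set σ := ∑' l, w l with hσ
  have hσpos : 0 < σ := hs.tsum_pos (fun l => (hw l).le) 0 (hw 0)
  have hpart : ∀ m, ∑ l ∈ Finset.range m, w l ≤ σ := fun m =>
    hs.sum_le_tsum _ fun l _ => (hw l).le
  -- The averages look at most σ away, so the plateau of radius 2σ leaves one of radius σ and the
  -- support stays within radius 4σ.
  let b : ContDiffBump (0 : ℝ) := ⟨2 * σ, 3 * σ, by positivity, by linarith⟩
  let f : ℝ → ℂ := fun x => ((b x : ℝ) : ℂ)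
  have hf : ContDiff ℝ ∞ f := Complex.ofRealCLM.contDiff.comp b.contDiff
  have hfs : HasCompactSupport f := b.hasCompactSupport.comp_left (g := fun t : ℝ => (t : ℂ)) rfl
  have hf1 : ∀ x, ‖f x‖ ≤ 1 := fun x => by
    simp only [f, Complex.norm_real, Real.norm_of_nonneg b.nonneg]
    exact b.le_one
  have hbd : ∀ k, ∃ C, ∀ x, ‖iteratedDeriv k f x‖ ≤ C := fun k => by
    obtain ⟨C, hC⟩ := (hf.continuous_iteratedFDeriv (m := k) (by exact_mod_cast le_top)
      ).bounded_above_of_compact_support (hfs.iteratedFDeriv k)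
    exact ⟨C, fun x => norm_iteratedFDeriv_eq_norm_iteratedDeriv (𝕜 := ℝ) (f := f) ▸ hC x⟩
  choose C hC using hbd
  let F := iterAvg w f
  have hF : ∀ m, ContDiff ℝ ∞ (F m) := contDiff_iterAvg hf
  have hg : ∀ i, ContDiff ℝ ∞ (fun x => F (i + 1) x - F i x) := fun i => (hF _).sub (hF i)
  have hgd : ∀ k i x, iteratedDeriv k (fun x => F (i + 1) x - F i x) x
      = iteratedDeriv k (F (i + 1)) x - iteratedDeriv k (F i) x := fun k i x =>
    iteratedDeriv_fun_sub ((hF _).contDiffAt.of_le (by exact_mod_cast le_top))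
      ((hF _).contDiffAt.of_le (by exact_mod_cast le_top))
  -- One more average moves the k-th derivative by at most w i times the supremum of the (k+1)-st,
  -- and that supremum is controlled by the initial bump.
  obtain ⟨hg1, hg2⟩ := contDiff_tsum_hasSum_iteratedDeriv hg
    (v := fun k i => C (k + 1) * w i) (fun k => hs.mul_left _) fun k i x => by
      rw [hgd]
      have : iteratedDeriv k (F (i + 1)) x = avg (w i) (iteratedDeriv k (F i)) x := by
        rw [← iteratedDeriv_avg (hF i)]; rfl
      rw [this]
      refine norm_avg_sub_self_le (hw i) ?_ (fun y => ?_) x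
      · rw [iteratedDeriv_eq_iterate]
        exact (hF i).iterate_deriv k
      · rw [← iteratedDeriv_succ]
        exact norm_iteratedDeriv_iterAvg_le_of_base hw hf (hC _) i y
  let χ : ℝ → ℂ := fun x => f x + ∑' i, (F (i + 1) x - F i x)
  have hχ : ContDiff ℝ ∞ χ := hf.add hg1
  have hlim : ∀ k x, Tendsto (fun m => iteratedDeriv k (F m) x) atTop
      (𝓝 (iteratedDeriv k χ x)) := by
    intro k x
    have h1 := (hg2 k x).tendsto_sum_nat
    simp only [hgd] at h1
    simp only [Finset.sum_range_sub (fun m => iteratedDeriv k (F m) x)] at h1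
    have h2 := h1.const_add (iteratedDeriv k f x)
    have h3 : iteratedDeriv k χ x = iteratedDeriv k f x +
        iteratedDeriv k (fun x => ∑' i, (F (i + 1) x - F i x)) x :=
      iteratedDeriv_fun_add (hf.contDiffAt.of_le (by exact_mod_cast le_top))
        (hg1.contDiffAt.of_le (by exact_mod_cast le_top))
    rw [h3]
    refine h2.congr fun m => ?_
    have : F 0 = f := rfl
    rw [this]; ring
  have hconst : ∀ x c, (∀ m, F m x = c) → χ x = c := fun x c h => by
    have := hlim 0 x
    simp only [iteratedDeriv_zero, h] at this
    exact tendsto_nhds_unique this tendsto_const_nhds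
  refine ⟨χ, hχ, ?_, fun x hx => ?_, fun m x => ?_⟩
  · filter_upwards [Metric.ball_mem_nhds (0 : ℝ) hσpos] with x hx
    rw [Metric.mem_ball, dist_zero_right, Real.norm_eq_abs] at hx
    refine hconst x 1 fun m => iterAvg_eq_of_eqOn hw hf m fun y hy => ?_
    have : b y = 1 := b.one_of_mem_closedBall (by
      rw [Metric.mem_closedBall, dist_zero_right, Real.norm_eq_abs]
      have := abs_sub_abs_le_abs_sub y x
      have := hpart m
      change |y| ≤ 2 * σ
      linarith)
    simp [f, this]
  · refine hconst x 0 fun m => iterAvg_eq_of_eqOn hw hf m fun y hy => ?_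
    have : b y = 0 := b.zero_of_le_dist (by
      rw [dist_zero_right, Real.norm_eq_abs]
      have := abs_sub_abs_le_abs_sub x y
      rw [abs_sub_comm x y] at this
      have := hpart m
      change 3 * σ ≤ |y|
      linarith)
    simp [f, this]
  · refine le_of_tendsto (hlim m x).norm ?_
    filter_upwards [eventually_ge_atTop m] with j hj
    exact norm_iteratedDeriv_iterAvg_le hw hf hf1 hj x

/-! ### Monomials -/

/-- The normalized monomial `x ^ k / k!`. -/
noncomputable def monomial (k : ℕ) (x : ℝ) : ℂ := (x : ℂ) ^ k / (k.factorial : ℂ)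

lemma contDiff_monomial (k : ℕ) : ContDiff ℝ ∞ (monomial k) :=
  (Complex.ofRealCLM.contDiff.pow k).div_const _

lemma hasDerivAt_monomial_succ (k : ℕ) (x : ℝ) :
    HasDerivAt (monomial (k + 1)) (monomial k x) x := by
  have h := ((hasDerivAt_pow (k + 1) (x : ℂ)).comp_ofReal).div_const ((k + 1).factorial : ℂ)
  have : (k.factorial : ℂ) ≠ 0 := by exact_mod_cast k.factorial_ne_zero
  have : (k + 1 : ℂ) ≠ 0 := by exact_mod_cast k.succ_ne_zero
  have e : monomial k x =
      ((k + 1 : ℕ) : ℂ) * (x : ℂ) ^ (k + 1 - 1) / ((k + 1).factorial : ℂ) := by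
    rw [monomial, Nat.factorial_succ]
    push_cast
    field_simp
  rw [e]
  exact h

/-- The `m`-th derivative of `x ^ k / k!`. -/
noncomputable def monomialDeriv (k m : ℕ) (x : ℝ) : ℂ := if m ≤ k then monomial (k - m) x else 0

lemma hasDerivAt_monomialDeriv (k m : ℕ) (x : ℝ) :
    HasDerivAt (monomialDeriv k m) (monomialDeriv k (m + 1) x) x := by
  unfold monomialDeriv
  rcases lt_trichotomy m k with h | rfl | h
  · obtain ⟨d, rfl⟩ := Nat.exists_eq_add_of_lt h
    simp only [show m ≤ m + d + 1 by omega, show m + 1 ≤ m + d + 1 by omega, if_true,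
      show m + d + 1 - m = d + 1 by omega, show m + d + 1 - (m + 1) = d by omega]
    exact hasDerivAt_monomial_succ d x
  · simp only [le_refl, if_true, Nat.sub_self, show ¬ m + 1 ≤ m by omega, if_false]
    have : monomial 0 = fun _ => 1 := by funext x; simp [monomial]
    rw [this]
    exact hasDerivAt_const x _
  · simp only [show ¬ m ≤ k by omega, show ¬ m + 1 ≤ k by omega, if_false]
    exact hasDerivAt_const x _

lemma iteratedDeriv_monomial (k m : ℕ) : iteratedDeriv m (monomial k) = monomialDeriv k m := by
  induction m with
  | zero => funext x; simp [monomialDeriv]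
  | succ m ih =>
    rw [iteratedDeriv_succ, ih]
    exact funext fun x => (hasDerivAt_monomialDeriv k m x).deriv

lemma norm_monomial (k : ℕ) (x : ℝ) : ‖monomial k x‖ = |x| ^ k / k.factorial := by
  simp [monomial]

lemma monomialDeriv_zero_right (k m : ℕ) :
    monomialDeriv k m 0 = if m = k then 1 else 0 := by
  unfold monomialDeriv
  rcases lt_trichotomy m k with h | rfl | h
  · simp [h.le, h.ne, monomial, show k - m ≠ 0 by omega]
  · simp [monomial]
  · simp [show ¬ m ≤ k by omega, h.ne']

/-! ### Auxiliary facts on series and products -/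

/-- With tails T, the series of u/√T telescopes against √T, so weights growing like 1/√T are
affordable. They widen the windows of the cut-off enough to place every single block in the Beurling
class. -/
lemma exists_tendsto_atTop_tsum_mul_le {u : ℕ → ℝ} (hu : ∀ k, 0 < u k) (hs : Summable u) :
    ∃ θ : ℕ → ℝ, (∀ k, 1 ≤ θ k) ∧ Tendsto θ atTop atTop ∧ Summable (fun k => θ k * u k) ∧
      ∑' k, θ k * u k ≤ 2 * ∑' k, u k := by
  let T : ℕ → ℝ := fun n => ∑' k, u (k + n)
  have hsn : ∀ n, Summable fun k => u (k + n) := fun n => (summable_nat_add_iff n).2 hs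
  have hTpos : ∀ n, 0 < T n := fun n => (hsn n).tsum_pos (fun k => (hu _).le) 0 (hu _)
  have hTsucc : ∀ n, u n = T n - T (n + 1) := fun n => by
    have := (hsn n).tsum_eq_zero_add
    simp only [zero_add] at this
    have h2 : ∀ k, u (k + 1 + n) = u (k + (n + 1)) := fun k => by congr 1; ring
    simp only [h2] at this
    simp only [T]; linarith
  have hT0 : Tendsto T atTop (𝓝 0) := tendsto_sum_nat_add u
  have hT00 : T 0 = ∑' k, u k := by simp [T]
  have hsq : ∀ n, Real.sqrt (T n) ^ 2 = T n := fun n => Real.sq_sqrt (hTpos n).le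
  have hsp : ∀ n, 0 < Real.sqrt (T n) := fun n => Real.sqrt_pos.2 (hTpos n)
  -- Since ∑ u/√T ≤ 2√(T 0), this factor makes the additional sum at most T 0 = ∑ u.
  let c := Real.sqrt (T 0) / 2
  have hc : 0 < c := half_pos (hsp 0)
  have hterm : ∀ n, u n / Real.sqrt (T n) ≤ 2 * (Real.sqrt (T n) - Real.sqrt (T (n + 1))) := by
    intro n
    rw [div_le_iff₀ (hsp n), hTsucc n]
    nlinarith [hsq n, hsq (n + 1), sq_nonneg (Real.sqrt (T n) - Real.sqrt (T (n + 1)))]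
  have hpart : ∀ n, ∑ k ∈ Finset.range n, u k / Real.sqrt (T k) ≤ 2 * Real.sqrt (T 0) := by
    intro n
    refine (Finset.sum_le_sum fun k _ => hterm k).trans ?_
    rw [← Finset.mul_sum, Finset.sum_range_sub']
    linarith [hsp n]
  have hnn : ∀ k, 0 ≤ u k / Real.sqrt (T k) := fun k => div_nonneg (hu k).le (hsp k).le
  have hs2 : Summable fun k => u k / Real.sqrt (T k) := summable_of_sum_range_le hnn hpart
  have heq : ∀ k, (1 + c / Real.sqrt (T k)) * u k = u k + c * (u k / Real.sqrt (T k)) :=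
    fun k => by ring
  refine ⟨fun k => 1 + c / Real.sqrt (T k), fun k => ?_, ?_, ?_, ?_⟩
  · have := div_pos hc (hsp k)
    linarith
  · refine tendsto_atTop_add_const_left _ _ ?_
    have h1 : Tendsto (fun k => Real.sqrt (T k)) atTop (𝓝[>] 0) := by
      refine tendsto_nhdsWithin_iff.2 ⟨?_, Eventually.of_forall fun k => hsp k⟩
      simpa using hT0.sqrt
    simpa [div_eq_mul_inv] using (h1.inv_tendsto_nhdsGT_zero).const_mul_atTop hc
  · simp only [heq]
    exact hs.add (hs2.mul_left c)
  · simp only [heq]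
    rw [hs.tsum_add (hs2.mul_left c), tsum_mul_left]
    have h1 : ∑' k, u k / Real.sqrt (T k) ≤ 2 * Real.sqrt (T 0) :=
      Real.tsum_le_of_sum_range_le hnn hpart
    have h2 : c * ∑' k, u k / Real.sqrt (T k) ≤ c * (2 * Real.sqrt (T 0)) :=
      mul_le_mul_of_nonneg_left h1 hc.le
    have h3 : c * (2 * Real.sqrt (T 0)) = T 0 := by
      rw [show c * (2 * Real.sqrt (T 0)) = Real.sqrt (T 0) ^ 2 by simp only [c]; ring, hsq 0]
    rw [hT00] at *
    linarith

lemma exists_prod_range_le {a b : ℕ → ℝ} (ha : ∀ l, 0 ≤ a l) (hb : ∀ l, 0 < b l)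
    (h : ∀ᶠ l in atTop, a l ≤ b l) :
    ∃ K, 0 < K ∧ ∀ m, ∏ l ∈ Finset.range m, a l ≤ K * ∏ l ∈ Finset.range m, b l := by
  obtain ⟨L, hL⟩ := eventually_atTop.1 h
  let g : ℕ → ℝ := fun l => max 1 (a l / b l)
  have hg1 : ∀ l, 1 ≤ g l := fun l => le_max_left _ _
  have hgL : ∀ l, L ≤ l → g l = 1 := fun l hl =>
    max_eq_left ((div_le_one (hb l)).2 (hL l hl))
  have hab : ∀ l, a l ≤ g l * b l := fun l => by
    rw [← div_le_iff₀ (hb l)]; exact le_max_right _ _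
  refine ⟨∏ l ∈ Finset.range L, g l, Finset.prod_pos fun l _ => one_pos.trans_le (hg1 l),
    fun m => ?_⟩
  refine (Finset.prod_le_prod (fun l _ => ha l) fun l _ => hab l).trans ?_
  rw [Finset.prod_mul_distrib]
  refine mul_le_mul_of_nonneg_right ?_ (Finset.prod_nonneg fun l _ => (hb l).le)
  rcases le_total m L with hm | hm
  · exact Finset.prod_le_prod_of_subset_of_one_le (Finset.range_mono hm)
      (fun l _ => zero_le_one.trans (hg1 l)) fun l _ _ => hg1 l
  · rw [← Finset.prod_subset (Finset.range_mono hm) fun l _ hl => hgL l (by simpa using hl)]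

/-! ### Building blocks of the extension -/

section Block

variable {r : ℕ} {N : ℕ → ℝ}

/-- Leibniz's rule: the binomial coefficients sum to 2^m, and derivatives of the monomial beyond
order k vanish. -/
lemma norm_iteratedDeriv_monomial_mul_le {χ : ℝ → ℂ} (hχ : ContDiff ℝ ∞ χ) (k m : ℕ) {x : ℝ}
    {E : ℕ → ℝ} (hE : ∀ i ≤ k, i ≤ m →
      ‖monomial (k - i) x‖ * ‖iteratedDeriv (m - i) χ x‖ ≤ E m) (hE0 : 0 ≤ E m) :
    ‖iteratedDeriv m (fun y => monomial k y * χ y) x‖ ≤ 2 ^ m * E m := by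
  rw [← norm_iteratedFDeriv_eq_norm_iteratedDeriv]
  refine (norm_iteratedFDeriv_mul_le (contDiff_monomial k) hχ x
    (by exact_mod_cast le_top)).trans ?_
  rw [show (2 : ℝ) ^ m = ∑ i ∈ Finset.range (m + 1), (m.choose i : ℝ) by
    exact_mod_cast (Nat.sum_range_choose m).symm, Finset.sum_mul]
  refine Finset.sum_le_sum fun i hi => ?_
  rw [norm_iteratedFDeriv_eq_norm_iteratedDeriv, norm_iteratedFDeriv_eq_norm_iteratedDeriv,
    mul_assoc]
  refine mul_le_mul_of_nonneg_left ?_ (by positivity)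
  rw [iteratedDeriv_monomial, monomialDeriv]
  split_ifs with h
  · exact hE i h (by have := Finset.mem_range.1 hi; omega)
  · simpa using hE0

/-- The block is a normalized monomial times a cut-off supported where |x| ≤ D(p+1)/(Hρ). The two
explicit bounds serve the summation over p. The last one, with a constant depending on the block,
serves the finitely many blocks not yet small in the Beurling case. -/
theorem exists_block (hN : IsLC N) {p : ℕ} {ρ H B C D : ℝ} (hρ : 0 < ρ)
    (hH : 0 < H) (hC : 1 ≤ C) (hB : 0 ≤ B) (hρq : ∀ l, r * p ≤ l → ρ ≤ C * step r N l)
    (hs : Summable fun l => (step r N (r * p + l))⁻¹)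
    (hsum : ∑' l, (step r N (r * p + l))⁻¹ ≤ B * (p + 1) / ρ)
    (hD : D = 4 * (r + 2 * B)) (hsupp : D * (p + 1) ≤ H * ρ) :
    ∃ φ : ℝ → ℂ, ContDiff ℝ ∞ φ ∧ (φ =ᶠ[𝓝 0] monomial (r * p)) ∧
      (∀ x, 1 ≤ |x| → φ x = 0) ∧
      (∀ m ≤ r * p, ∀ x, ‖iteratedDeriv m φ x‖ ≤
        (2 * C) ^ m * Real.exp (D * (p + 1)) * ((H * ρ) ^ (r * p - m))⁻¹) ∧
      (∀ m, r * p ≤ m → ∀ x, ‖iteratedDeriv m φ x‖ ≤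
        (2 * C) ^ m * Real.exp (D * (p + 1)) * H ^ (m - r * p) *
          (interp r N m / interp r N (r * p))) ∧
      (∀ h, 0 < h → ∃ K, ∀ m x, ‖iteratedDeriv m φ x‖ ≤ K * h ^ m * interp r N m) := by
  obtain ⟨θ, hθ1, hθ, hθs, hθsum⟩ := exists_tendsto_atTop_tsum_mul_le
    (fun l => inv_pos.2 (step_pos (r := r) hN (r * p + l))) hs
  have hq : ∀ l, 0 < step r N l := step_pos hN
  -- Up to order rp every derivative costs Hρ, matching the scale of the monomial; afterwards it
  -- costs at most H times the quotient of `interp`, less by the growing weight θ.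
  let w : ℕ → ℝ := fun l => if l < r * p then (H * ρ)⁻¹ else
    H⁻¹ * (θ (l - r * p) * (step r N l)⁻¹)
  have hθ0 : ∀ l, 0 < θ l := fun l => one_pos.trans_le (hθ1 l)
  have hwpos : ∀ l, 0 < w l := fun l => by
    simp only [w]
    split_ifs
    · positivity
    · have := hθ0 (l - r * p); have := hq l; positivity
  have htail : ∀ l, w (l + r * p) = H⁻¹ * (θ l * (step r N (r * p + l))⁻¹) := fun l => by
    simp [w, add_comm l]
  have hwsum : Summable w := by
    rw [← summable_nat_add_iff (r * p)]
    simp only [htail]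
    exact hθs.mul_left _
  have hwle : 4 * ∑' l, w l ≤ D * (p + 1) / (H * ρ) := by
    rw [← hwsum.sum_add_tsum_nat_add (r * p)]
    simp only [htail]
    rw [tsum_mul_left, Finset.sum_congr rfl (g := fun _ => (H * ρ)⁻¹) fun l hl => by
      simp [w, Finset.mem_range.1 hl], Finset.sum_const, Finset.card_range, nsmul_eq_mul]
    have h1 : ∑' l, θ l * (step r N (r * p + l))⁻¹ ≤ 2 * (B * (p + 1) / ρ) :=
      hθsum.trans (by linarith)
    have h2 : H⁻¹ * ∑' l, θ l * (step r N (r * p + l))⁻¹ ≤ H⁻¹ * (2 * (B * (p + 1) / ρ)) :=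
      mul_le_mul_of_nonneg_left h1 (by positivity)
    have h3 : D * (p + 1) / (H * ρ) - 4 * (((r * p : ℕ) : ℝ) * (H * ρ)⁻¹ +
        H⁻¹ * (2 * (B * (p + 1) / ρ))) = 4 * r / (H * ρ) := by
      rw [hD]; push_cast; field_simp; ring
    have h4 : (0 : ℝ) ≤ 4 * r / (H * ρ) := by positivity
    linarith
  have hR : D * (p + 1) / (H * ρ) ≤ 1 := (div_le_one (by positivity)).2 hsupp
  obtain ⟨χ, hχ, hχ1, hχ0, hχb⟩ := exists_cutoff hwpos hwsum
  have hD0 : 0 ≤ D := by rw [hD]; positivity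
  let φ : ℝ → ℂ := fun y => monomial (r * p) y * χ y
  have hφ0 : ∀ x, 4 * ∑' l, w l < |x| → ∀ m, iteratedDeriv m φ x = 0 := fun x hx m => by
    have : φ =ᶠ[𝓝 x] fun _ => 0 := by
      filter_upwards [continuous_abs.continuousAt.eventually (lt_mem_nhds hx)] with y hy
      simp [φ, hχ0 y hy.le]
    rw [this.iteratedDeriv_eq m]
    simp
  -- Up to the factor H and the weights θ ≥ 1 these are the inverse windows. The hypothesis ρ ≤ C g
  -- lets a derivative falling on the monomial be charged like one falling on the cut-off.
  let g : ℕ → ℝ := fun l => if l < r * p then ρ else step r N l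
  have hg : ∀ l, 0 < g l := fun l => by simp only [g]; split_ifs <;> simp [hρ, hq]
  have hρg : ∀ l, ρ ≤ C * g l := fun l => by
    simp only [g]
    split_ifs with h
    · nlinarith
    · exact hρq l (by omega)
  let Γ : ℕ → ℝ := fun j => ∏ l ∈ Finset.range j, g l
  have hΓ : ∀ j, 0 < Γ j := fun j => Finset.prod_pos fun l _ => hg l
  have hΓi : ∀ m i, i ≤ m → ρ ^ i * Γ (m - i) ≤ C ^ m * Γ m := by
    intro m i him
    obtain ⟨j, rfl⟩ := Nat.exists_eq_add_of_le' him
    rw [Nat.add_sub_cancel]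
    have h1 : Γ (j + i) = Γ j * ∏ l ∈ Finset.range i, g (j + l) := Finset.prod_range_add _ _ _
    have h2 : ρ ^ i ≤ C ^ i * ∏ l ∈ Finset.range i, g (j + l) := by
      have := Finset.prod_le_prod (s := Finset.range i) (f := fun _ => ρ)
        (g := fun l => C * g (j + l)) (fun _ _ => hρ.le) fun l _ => hρg _
      simpa [Finset.prod_mul_distrib] using this
    have h3 : C ^ i ≤ C ^ (j + i) := pow_le_pow_right₀ hC (by omega)
    have h4 : 0 < ∏ l ∈ Finset.range i, g (j + l) := Finset.prod_pos fun l _ => hg _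
    calc ρ ^ i * Γ j ≤ (C ^ (j + i) * ∏ l ∈ Finset.range i, g (j + l)) * Γ j := by
          refine mul_le_mul_of_nonneg_right (h2.trans ?_) (hΓ j).le
          exact mul_le_mul_of_nonneg_right h3 h4.le
      _ = C ^ (j + i) * Γ (j + i) := by rw [h1]; ring
  have hχΓ : ∀ j x, ‖iteratedDeriv j χ x‖ ≤ H ^ j * Γ j := fun j x => by
    refine (hχb j x).trans ?_
    have : H ^ j * Γ j = ∏ l ∈ Finset.range j, (H * g l) := by
      simp [Finset.prod_mul_distrib, Γ]
    rw [this]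
    refine Finset.prod_le_prod (fun l _ => (inv_pos.2 (hwpos l)).le) fun l _ => ?_
    simp only [w, g]
    split_ifs with h
    · simp
    · rw [mul_inv, mul_inv, inv_inv, inv_inv]
      refine mul_le_mul_of_nonneg_left ?_ hH.le
      have := inv_le_one_of_one_le₀ (hθ1 (l - r * p))
      exact mul_le_of_le_one_left (hq l).le this
  have hmain : ∀ m x, ‖iteratedDeriv m φ x‖ ≤
      2 ^ m * (Real.exp (D * (p + 1)) * C ^ m * (H ^ m * Γ m) / (H * ρ) ^ (r * p)) := by
    intro m x
    have hnn : 0 ≤ Real.exp (D * (p + 1)) * C ^ m * (H ^ m * Γ m) / (H * ρ) ^ (r * p) := by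
      have := hΓ m; positivity
    rcases lt_or_ge (4 * ∑' l, w l) |x| with hx | hx
    · rw [hφ0 x hx m, norm_zero]; positivity
    refine norm_iteratedDeriv_monomial_mul_le hχ (r * p) m (E := fun m =>
      Real.exp (D * (p + 1)) * C ^ m * (H ^ m * Γ m) / (H * ρ) ^ (r * p)) (fun i hi him => ?_) hnn
    -- The factorial is used up by y^k/k! ≤ e^y with y = D(p+1), leaving only an exponential in p.
    have h1 : ‖monomial (r * p - i) x‖ ≤
        Real.exp (D * (p + 1)) * ((H * ρ) ^ (r * p - i))⁻¹ := by
      rw [norm_monomial]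
      calc |x| ^ (r * p - i) / (r * p - i).factorial
          ≤ (D * (p + 1) / (H * ρ)) ^ (r * p - i) / (r * p - i).factorial := by
            have := hx.trans hwle
            gcongr
        _ = (D * (p + 1)) ^ (r * p - i) / (r * p - i).factorial * ((H * ρ) ^ (r * p - i))⁻¹ := by
            rw [div_pow]; ring
        _ ≤ _ := by
            gcongr
            exact Real.pow_div_factorial_le_exp _ (by positivity) _
    calc ‖monomial (r * p - i) x‖ * ‖iteratedDeriv (m - i) χ x‖
        ≤ (Real.exp (D * (p + 1)) * ((H * ρ) ^ (r * p - i))⁻¹) * (H ^ (m - i) * Γ (m - i)) := by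
          gcongr; exact hχΓ _ _
      _ = Real.exp (D * (p + 1)) * (H ^ m * (ρ ^ i * Γ (m - i))) / (H * ρ) ^ (r * p) := by
          have e1 : (H * ρ) ^ (r * p) = (H * ρ) ^ (r * p - i) * (H ^ i * ρ ^ i) := by
            rw [← mul_pow, ← pow_add, Nat.sub_add_cancel hi]
          have e2 : H ^ m = H ^ (m - i) * H ^ i := by rw [← pow_add, Nat.sub_add_cancel him]
          rw [e1, e2]
          field_simp
      _ ≤ Real.exp (D * (p + 1)) * (H ^ m * (C ^ m * Γ m)) / (H * ρ) ^ (r * p) := by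
          have := hΓi m i him
          gcongr
      _ = _ := by ring
  refine ⟨φ, (contDiff_monomial _).mul hχ, ?_, ?_, ?_, ?_, ?_⟩
  · filter_upwards [hχ1] with x hx
    simp [φ, hx]
  · intro x hx
    simp [φ, hχ0 x ((hwle.trans hR).trans hx)]
  · intro m hm x
    refine (hmain m x).trans_eq ?_
    have e1 : Γ m = ρ ^ m := by
      simp only [Γ]
      rw [Finset.prod_congr rfl (g := fun _ => ρ) fun l hl => ?_]
      · simp
      · simp [g, (Finset.mem_range.1 hl).trans_le hm]
    have e2 : (H * ρ) ^ (r * p) = (H * ρ) ^ (r * p - m) * (H ^ m * ρ ^ m) := by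
      rw [← mul_pow, ← pow_add, Nat.sub_add_cancel hm]
    rw [e1, e2, mul_pow 2 C]
    field_simp
  · intro m hm x
    refine (hmain m x).trans_eq ?_
    obtain ⟨d, rfl⟩ := Nat.exists_eq_add_of_le hm
    have e1 : Γ (r * p + d) = ρ ^ (r * p) * (interp r N (r * p + d) / interp r N (r * p)) := by
      rw [interp_add, mul_div_cancel_left₀ _ (interp_pos hN _).ne']
      simp only [Γ]
      rw [Finset.prod_range_add]
      congr 1
      · rw [Finset.prod_congr rfl (g := fun _ => ρ) fun l hl => ?_]
        · simp
        · simp [g, Finset.mem_range.1 hl]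
      · exact Finset.prod_congr rfl fun l _ => by simp [g]
    rw [e1, Nat.add_sub_cancel_left, mul_pow, mul_pow, pow_add H]
    field_simp
  · intro h hh
    -- For large l the inverse window is (H/θ) times the quotient, and θ → ∞. Aiming at h/2 pays for
    -- the 2^m of Leibniz's rule.
    obtain ⟨K, hK, hKb⟩ := exists_prod_range_le (a := fun l => (w l)⁻¹)
      (b := fun l => h / 2 * step r N l) (fun l => (inv_pos.2 (hwpos l)).le)
      (fun l => mul_pos (half_pos hh) (hq l)) (by
        have h1 : ∀ᶠ l in atTop, H / (h / 2) ≤ θ (l - r * p) :=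
          ((tendsto_sub_atTop_nat (r * p)).eventually (hθ.eventually_ge_atTop _))
        filter_upwards [h1, eventually_ge_atTop (r * p)] with l hl hlp
        simp only [w, show ¬ l < r * p by omega, if_false]
        rw [mul_inv, mul_inv, inv_inv, inv_inv, ← mul_assoc]
        refine mul_le_mul_of_nonneg_right ?_ (hq l).le
        rw [div_le_iff₀ (half_pos hh)] at hl
        rw [← div_eq_mul_inv, div_le_iff₀ (hθ0 _)]
        linarith)
    let c := max 1 (2 / h)
    have hc1 : 1 ≤ c := le_max_left _ _
    refine ⟨K * c ^ (r * p), fun m x => ?_⟩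
    have hnn : 0 ≤ K * c ^ (r * p) * (h / 2) ^ m * interp r N m := by
      have := (interp_pos (r := r) hN m).le; positivity
    rcases lt_or_ge (4 * ∑' l, w l) |x| with hx | hx
    · rw [hφ0 x hx m, norm_zero]
      have := (interp_pos (r := r) hN m).le; positivity
    refine (norm_iteratedDeriv_monomial_mul_le hχ (r * p) m (E := fun m =>
      K * c ^ (r * p) * (h / 2) ^ m * interp r N m) (fun i hi him => ?_) hnn).trans_eq ?_
    · have h1 : ‖monomial (r * p - i) x‖ ≤ 1 := by
        rw [norm_monomial]
        refine div_le_one_of_le₀ ?_ (by positivity)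
        refine (pow_le_one₀ (abs_nonneg x) ((hx.trans hwle).trans hR)).trans ?_
        exact_mod_cast Nat.factorial_pos _
      have h2 : ‖iteratedDeriv (m - i) χ x‖ ≤ K * ((h / 2) ^ (m - i) * interp r N (m - i)) := by
        refine (hχb _ x).trans ((hKb _).trans_eq ?_)
        rw [Finset.prod_mul_distrib, Finset.prod_const, Finset.card_range, interp]
      have h3 : (h / 2) ^ (m - i) ≤ c ^ (r * p) * (h / 2) ^ m := by
        have e : (h / 2) ^ (m - i) = (2 / h) ^ i * (h / 2) ^ m := by
          rw [← Nat.sub_add_cancel him, pow_add, Nat.add_sub_cancel, ← mul_assoc,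
            mul_comm ((2 / h) ^ i), mul_assoc, ← mul_pow]
          field_simp
          simp
        rw [e]
        gcongr
        exact (pow_le_pow_left₀ (by positivity) (le_max_right _ _) i).trans
          (pow_le_pow_right₀ hc1 hi)
      calc _ ≤ 1 * (K * ((h / 2) ^ (m - i) * interp r N (m - i))) := by gcongr
        _ ≤ K * ((c ^ (r * p) * (h / 2) ^ m) * interp r N m) := by
            rw [one_mul]
            have := (interp_pos (r := r) hN (m - i)).le
            gcongr
            exact interp_mono hN (Nat.sub_le _ _)
        _ = _ := by ring
    · rw [div_pow]
      field_simp

end Block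

/-! ### The numbers `λ_{p,s}` -/

section Lam

variable {M N : ℕ → ℝ} {p s : ℕ}

lemma rpow_one_div_sub_pow {x : ℝ} (hx : 0 ≤ x) {j : ℕ} (hj : j < p) :
    (x ^ (1 / ((p : ℝ) - (j : ℝ)))) ^ (p - j) = x := by
  rw [← Nat.cast_sub hj.le]
  exact rpow_one_div_pow hx (by omega)

lemma lam_arg_pos (hM : IsLC M) (hN : IsLC N) (hs : 1 ≤ s) (j : ℕ) :
    0 < M p / ((s : ℝ) ^ p * N j) := by
  have := hM.pos p
  have := hN.pos j
  have : (0 : ℝ) < s := by exact_mod_cast hs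
  positivity

lemma le_lam (j : Fin p) :
    (M p / ((s : ℝ) ^ p * N j)) ^ (1 / ((p : ℝ) - (j : ℝ))) ≤ lam M N p s :=
  le_ciSup (f := fun j : Fin p => (M p / ((s : ℝ) ^ p * N j)) ^ (1 / ((p : ℝ) - (j : ℝ))))
    (Set.finite_range _).bddAbove j

lemma lam_pos (hM : IsLC M) (hN : IsLC N) (hs : 1 ≤ s) (hp : 1 ≤ p) : 0 < lam M N p s :=
  (Real.rpow_pos_of_pos (lam_arg_pos hM hN hs 0) _).trans_le (le_lam (⟨0, hp⟩ : Fin p))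

lemma le_mul_lam_pow (hM : IsLC M) (hN : IsLC N) (hs : 1 ≤ s) {j : ℕ} (hj : j < p) :
    M p ≤ (s : ℝ) ^ p * N j * lam M N p s ^ (p - j) := by
  have hpos := lam_arg_pos (p := p) hM hN hs j
  have h1 := pow_le_pow_left₀ (Real.rpow_nonneg hpos.le _)
    (le_lam (M := M) (N := N) (s := s) (⟨j, hj⟩ : Fin p)) (p - j)
  simp only at h1
  rw [rpow_one_div_sub_pow hpos.le hj] at h1
  have : (0 : ℝ) < s := by exact_mod_cast hs
  have := hN.pos j
  rwa [div_le_iff₀' (by positivity)] at h1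

lemma lam_le (hM : IsLC M) (hN : IsLC N) (hs : 1 ≤ s) (hp : 1 ≤ p) {x : ℝ} (hx : 0 ≤ x)
    (h : ∀ j < p, M p ≤ (s : ℝ) ^ p * N j * x ^ (p - j)) : lam M N p s ≤ x := by
  have : Nonempty (Fin p) := ⟨⟨0, hp⟩⟩
  refine ciSup_le fun j => ?_
  have hpos := lam_arg_pos (p := p) hM hN hs j
  refine le_of_pow_le_pow_left₀ (n := p - j) (by have := j.2; omega) hx ?_
  rw [rpow_one_div_sub_pow hpos.le j.2]
  have : (0 : ℝ) < s := by exact_mod_cast hs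
  have := hN.pos j
  rw [div_le_iff₀' (by positivity)]
  exact h j j.2

lemma lam_anti (hM : IsLC M) (hN : IsLC N) (hs : 1 ≤ s) (hp : 1 ≤ p) {s' : ℕ} (h : s ≤ s') :
    lam M N p s' ≤ lam M N p s := by
  refine lam_le hM hN (hs.trans h) hp (lam_pos hM hN hs hp).le fun j hj => ?_
  refine (le_mul_lam_pow hM hN hs hj).trans ?_
  have := hN.pos j
  have := lam_pos hM hN hs hp
  gcongr

/-- Log-convexity gives N_p ≤ N_j ν_p^{p-j}, and s^p absorbs C₂^p. This comparison makes ρ_p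
compatible with the later quotients and controls the term k = p in `SV`. -/
lemma lam_le_mul_quot (hM : IsLC M) (hN : IsLC N) (hs : 1 ≤ s) (hp : 1 ≤ p) {C₁ C₂ : ℝ}
    (hC₁ : 1 ≤ C₁) (hC₂ : 1 ≤ C₂) (hs2 : C₂ ≤ s) (h : ∀ p, M p ≤ C₁ * C₂ ^ p * N p) :
    lam M N p s ≤ C₁ * quot N p := by
  have hq := hN.quot_pos p
  refine lam_le hM hN hs hp (by positivity) fun j hj => (h p).trans ?_
  obtain ⟨i, rfl⟩ := Nat.exists_eq_add_of_le hj.le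
  have h1 := hN.apply_add_le j i
  have hNj := hN.pos j
  rw [Nat.add_sub_cancel_left, mul_pow]
  have h2 : C₁ ≤ C₁ ^ i := le_self_pow₀ hC₁ (by omega)
  have h3 : C₂ ^ (j + i) ≤ (s : ℝ) ^ (j + i) := by gcongr
  calc C₁ * C₂ ^ (j + i) * N (j + i)
      ≤ C₁ ^ i * (s : ℝ) ^ (j + i) * (N j * quot N (j + i) ^ i) := by gcongr; exact (hN.pos _).le
    _ = _ := by ring

end Lam

/-! ### From the summability condition to the parameters of the blocks -/

lemma sum_range_mul_div {r : ℕ} (hr : 1 ≤ r) (f : ℕ → ℝ) (n : ℕ) :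
    ∑ l ∈ Finset.range (r * n), f (l / r) = r * ∑ k ∈ Finset.range n, f k := by
  induction n with
  | zero => simp
  | succ n ih =>
    rw [Nat.mul_succ, Finset.sum_range_add, ih, Finset.sum_range_succ, mul_add]
    congr 1
    rw [Finset.sum_congr rfl (g := fun _ => f n) fun i hi => by
      rw [Nat.mul_add_div (by omega), Nat.div_eq_of_lt (Finset.mem_range.1 hi), add_zero]]
    simp

lemma inv_step_mul_add {r : ℕ} (hr : 1 ≤ r) {N : ℕ → ℝ} (hN : IsLC N) (p l : ℕ) :
    (step r N (r * p + l))⁻¹ = (1 / quot N (p + l / r + 1)) ^ (1 / (r : ℝ)) := by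
  rw [step, Nat.mul_add_div (by omega), one_div (quot _ _), Real.inv_rpow (hN.quot_pos _).le]

/-- The quantitative content of `SV` for the construction of extensions. -/
structure BlockData (r : ℕ) (M N : ℕ → ℝ) (ρ : ℕ → ℝ) (B C K A : ℝ) : Prop where
  pos : ∀ p, 0 < ρ p
  one_le_C : 1 ≤ C
  one_le_K : 1 ≤ K
  one_le_A : 1 ≤ A
  nonneg_B : 0 ≤ B
  le_step : ∀ p l, r * p ≤ l → ρ p ≤ C * step r N l
  summable : ∀ p, Summable fun l => (step r N (r * p + l))⁻¹
  tsum_le : ∀ p, ∑' l, (step r N (r * p + l))⁻¹ ≤ B * (p + 1) / ρ p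
  le_mul : ∀ p n, n ≤ p → M p ≤ K * A ^ p * ρ p ^ (r * p - r * n) * N n

/-- The choice is ρ_p = λ_{p,s}^{1/r}. Enlarging s above C₂ is harmless because λ decreases in s,
and each term of the series in `SV` is counted r times. -/
lemma exists_blockData {r : ℕ} (hr : 1 ≤ r) {M N : ℕ → ℝ} (hM : IsLC M) (hN : IsLC N)
    (hMN : Preceq M N) (h : SV r M N) :
    ∃ (ρ : ℕ → ℝ) (B C K A : ℝ), BlockData r M N ρ B C K A := by
  obtain ⟨C₁, C₂, hC₁, hC₂, hle⟩ := hMN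
  obtain ⟨s₀, hs₀, C₀, hSV⟩ := h
  let s := max s₀ ⌈C₂⌉₊
  have hs1 : 1 ≤ s := hs₀.trans (le_max_left _ _)
  have hs2 : C₂ ≤ s := (Nat.le_ceil C₂).trans (by exact_mod_cast le_max_right _ _)
  let u : ℕ → ℕ → ℝ := fun p k => (1 / quot N (p + k)) ^ (1 / (r : ℝ))
  have hu0 : ∀ p k, 0 ≤ u p k := fun p k =>
    Real.rpow_nonneg (one_div_nonneg.2 (hN.quot_pos _).le) _
  have hus : ∀ p, 1 ≤ p → Summable (u p) := fun p hp => (hSV p hp).1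
  have hlampos : ∀ p, 1 ≤ p → 0 < lam M N p s := fun p hp => lam_pos hM hN hs1 hp
  have hut : ∀ p, 1 ≤ p → ∑' k, u p k ≤ C₀ * p / lam M N p s ^ (1 / (r : ℝ)) := by
    intro p hp
    have h1 := (hSV p hp).2
    have hl := Real.rpow_pos_of_pos (hlampos p hp) (1 / (r : ℝ))
    have hp0 : (0 : ℝ) < p := by exact_mod_cast hp
    rw [le_div_iff₀ hl]
    have h2 : lam M N p s ^ (1 / (r : ℝ)) / p * ∑' k, u p k ≤ C₀ := by
      refine le_trans (mul_le_mul_of_nonneg_right ?_ (tsum_nonneg (hu0 p))) h1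
      have := lam_anti hM hN hs₀ hp (le_max_left s₀ ⌈C₂⌉₊)
      have h3 := (hlampos p hp).le
      gcongr
    rw [div_mul_eq_mul_div, div_le_iff₀ hp0] at h2
    linarith
  have hstep : ∀ p l, (step r N (r * p + l))⁻¹ = u (p + 1) (l / r) := fun p l => by
    rw [inv_step_mul_add hr hN]
    simp only [u]
    congr 3; ring
  have hpart : ∀ p n, ∑ l ∈ Finset.range n, (step r N (r * p + l))⁻¹ ≤ r * ∑' k, u (p + 1) k := by
    intro p n
    simp only [hstep]
    refine (Finset.sum_le_sum_of_subset_of_nonneg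
      (Finset.range_mono (Nat.le_mul_of_pos_left n hr)) fun l _ _ => hu0 _ _).trans ?_
    rw [sum_range_mul_div hr]
    exact mul_le_mul_of_nonneg_left ((hus _ (by omega)).sum_le_tsum _ fun _ _ => hu0 _ _)
      (Nat.cast_nonneg _)
  have hnn : ∀ p l, 0 ≤ (step r N (r * p + l))⁻¹ := fun p l => (inv_pos.2 (step_pos hN _)).le
  -- At p = 0 the supremum is over an empty type and equals 0, so a positive value is put in by
  -- hand; the maximum with S in the constant B accounts for it.
  let ρ : ℕ → ℝ := fun p => if p = 0 then 1 else lam M N p s ^ (1 / (r : ℝ))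
  have hρ : ∀ p, 1 ≤ p → ρ p = lam M N p s ^ (1 / (r : ℝ)) := fun p hp => by
    simp [ρ, show p ≠ 0 by omega]
  have hρ0 : ρ 0 = 1 := by simp [ρ]
  let S := ∑' k, u 1 k
  have hS : 0 ≤ S := tsum_nonneg (hu0 1)
  have hC₁r : 1 ≤ C₁ ^ (1 / (r : ℝ)) := Real.one_le_rpow hC₁ (by positivity)
  refine ⟨ρ, r * (max C₀ S), C₁ ^ (1 / (r : ℝ)), C₁, s, ?_, hC₁r, hC₁, by exact_mod_cast hs1,
    by have := le_max_right C₀ S; positivity, ?_, ?_, ?_, ?_⟩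
  · intro p
    rcases Nat.eq_zero_or_pos p with rfl | hp
    · simp [hρ0]
    · rw [hρ p hp]; exact Real.rpow_pos_of_pos (hlampos p hp) _
  · intro p l hl
    rcases Nat.eq_zero_or_pos p with rfl | hp
    · rw [hρ0]
      nlinarith [one_le_step (r := r) hN l]
    · rw [hρ p hp, step, ← Real.mul_rpow (by linarith) (hN.quot_pos _).le]
      refine Real.rpow_le_rpow (hlampos p hp).le ?_ (by positivity)
      refine (lam_le_mul_quot hM hN hs1 hp hC₁ hC₂ hs2 hle).trans ?_
      refine mul_le_mul_of_nonneg_left (hN.quot_mono ?_) (by linarith)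
      have : p ≤ l / r := by rw [Nat.le_div_iff_mul_le (by omega), mul_comm]; exact hl
      omega
  · exact fun p => summable_of_sum_range_le (hnn p) (hpart p)
  · intro p
    refine (Real.tsum_le_of_sum_range_le (hnn p) (hpart p)).trans ?_
    rw [mul_assoc, mul_div_assoc]
    refine mul_le_mul_of_nonneg_left ?_ (Nat.cast_nonneg _)
    rcases Nat.eq_zero_or_pos p with rfl | hp
    · simp [hρ0, S]
    · have h1 : ∑' k, u (p + 1) k ≤ ∑' k, u p k := by
        refine (hus _ (by omega)).tsum_le_tsum (fun k => ?_) (hus p hp)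
        refine Real.rpow_le_rpow (one_div_nonneg.2 (hN.quot_pos _).le) ?_ (by positivity)
        exact one_div_le_one_div_of_le (hN.quot_pos _) (hN.quot_mono (by omega))
      refine (h1.trans (hut p hp)).trans ?_
      rw [hρ p hp]
      have h2 := Real.rpow_pos_of_pos (hlampos p hp) (1 / (r : ℝ))
      have h3 := le_max_left C₀ S
      have h4 := hS.trans (le_max_right C₀ S)
      gcongr
      linarith
  · intro p n hn
    rw [← Nat.mul_sub, pow_mul]
    have hNn := hN.pos n
    rcases hn.lt_or_eq with hlt | rfl
    · rw [hρ p (by omega), rpow_one_div_pow (hlampos p (by omega)).le hr]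
      refine (le_mul_lam_pow hM hN hs1 hlt).trans ?_
      have := hlampos p (by omega)
      calc (s : ℝ) ^ p * N n * lam M N p s ^ (p - n)
          = 1 * ((s : ℝ) ^ p * lam M N p s ^ (p - n) * N n) := by ring
        _ ≤ C₁ * ((s : ℝ) ^ p * lam M N p s ^ (p - n) * N n) := by gcongr
        _ = _ := by ring
    · refine (hle n).trans ?_
      simp only [Nat.sub_self, pow_zero, mul_one]
      gcongr

/-! ### Surjectivity -/

/-- The derivative vanishes at -2, and every point of [-1,1] is within distance 4 of it. Iterated,
this bounds the derivatives whose order is not a multiple of r. -/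
lemma norm_iteratedDeriv_le_of_succ {ψ : ℝ → ℂ} (hψ : ContDiff ℝ ∞ ψ)
    (h0 : ∀ x, 1 ≤ |x| → ψ x = 0) {m : ℕ} {Y : ℝ}
    (h : ∀ x, ‖iteratedDeriv (m + 1) ψ x‖ ≤ Y) (x : ℝ) : ‖iteratedDeriv m ψ x‖ ≤ 4 * Y := by
  have hY : 0 ≤ Y := (norm_nonneg _).trans (h 0)
  have hz : ∀ y : ℝ, 1 < |y| → iteratedDeriv m ψ y = 0 := fun y hy => by
    have : ψ =ᶠ[𝓝 y] fun _ => 0 := by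
      filter_upwards [continuous_abs.continuousAt.eventually (lt_mem_nhds hy)] with z hz
      exact h0 z hz.le
    rw [this.iteratedDeriv_eq m]
    simp
  rcases lt_or_ge 1 |x| with hx | hx
  · rw [hz x hx, norm_zero]; positivity
  · have h1 := convex_univ.norm_image_sub_le_of_norm_deriv_le (f := iteratedDeriv m ψ) (C := Y)
      (fun z _ => (hψ.differentiable_iteratedDeriv m (by exact_mod_cast ENat.natCast_lt_top m)) z)
      (fun z _ => by rw [← iteratedDeriv_succ]; exact h z) (mem_univ (-2)) (mem_univ x)
    rw [hz (-2) (by norm_num), sub_zero] at h1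
    refine h1.trans ?_
    rw [mul_comm]
    refine mul_le_mul_of_nonneg_right ?_ hY
    rw [Real.norm_eq_abs, abs_le]
    constructor <;> linarith [abs_le.1 hx]

lemma norm_iteratedDeriv_le_of_add {ψ : ℝ → ℂ} (hψ : ContDiff ℝ ∞ ψ)
    (h0 : ∀ x, 1 ≤ |x| → ψ x = 0) {m i : ℕ} {Y : ℝ}
    (h : ∀ x, ‖iteratedDeriv (m + i) ψ x‖ ≤ Y) (x : ℝ) :
    ‖iteratedDeriv m ψ x‖ ≤ 4 ^ i * Y := by
  induction i generalizing Y with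
  | zero => simpa using h x
  | succ i ih =>
    rw [pow_succ, mul_assoc]
    exact ih fun y => norm_iteratedDeriv_le_of_succ hψ h0 h y

lemma iteratedDeriv_zero_of_eventuallyEq_monomial {φ : ℝ → ℂ} {k : ℕ}
    (h : φ =ᶠ[𝓝 0] monomial k) (m : ℕ) : iteratedDeriv m φ 0 = if m = k then 1 else 0 := by
  rw [h.iteratedDeriv_eq m, iteratedDeriv_monomial, monomialDeriv_zero_right]

section Surjectivity

variable {r : ℕ} {M N ρ : ℕ → ℝ} {B C K A : ℝ}

lemma BlockData.exists_block (hb : BlockData r M N ρ B C K A) (hr : 1 ≤ r) (hM : IsLC M)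
    (hN : IsLC N) {D H : ℝ} (hD : D = 4 * (r + 2 * B)) (hH : 0 < H) (p : ℕ)
    (hsupp : D * (p + 1) ≤ H * ρ p) :
    ∃ φ : ℝ → ℂ, ContDiff ℝ ∞ φ ∧ (φ =ᶠ[𝓝 0] monomial (r * p)) ∧
      (∀ x, 1 ≤ |x| → φ x = 0) ∧
      (∀ n x, M p * ‖iteratedDeriv (r * n) φ x‖ ≤ K * Real.exp D *
        (((2 * C) ^ r * H ^ r) ^ n * (A * Real.exp D / H ^ r) ^ p * N n)) ∧
      (∀ h, 0 < h → ∃ K', ∀ n x, ‖iteratedDeriv (r * n) φ x‖ ≤ K' * h ^ n * N n) := by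
  have hρ := hb.pos p
  obtain ⟨φ, h1, h2, h3, h4, h5, h6⟩ := RamifiedBorel.exists_block hN hρ hH hb.one_le_C
    hb.nonneg_B (hb.le_step p) (hb.summable p) (hb.tsum_le p) hD hsupp
  have hMp := hM.pos p
  have hC0 : 0 < C := one_pos.trans_le hb.one_le_C
  have hA0 : 0 < A := one_pos.trans_le hb.one_le_A
  have hK0 : 0 < K := one_pos.trans_le hb.one_le_K
  have hexp : Real.exp (D * (p + 1)) = Real.exp D ^ p * Real.exp D := by
    rw [mul_add, Real.exp_add, mul_one, mul_comm D, Real.exp_nat_mul]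
  refine ⟨φ, h1, h2, h3, fun n x => ?_, fun h hh => ?_⟩
  · have hNn := hN.pos n
    rcases le_total n p with hnp | hnp
    · have hmul : r * n ≤ r * p := Nat.mul_le_mul_left r hnp
      have e : H ^ (r * p) = H ^ (r * p - r * n) * H ^ (r * n) := by
        rw [← pow_add, Nat.sub_add_cancel hmul]
      calc M p * ‖iteratedDeriv (r * n) φ x‖
          ≤ (K * A ^ p * ρ p ^ (r * p - r * n) * N n) * ((2 * C) ^ (r * n) *
            Real.exp (D * (p + 1)) * ((H * ρ p) ^ (r * p - r * n))⁻¹) := by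
            gcongr
            · exact hb.le_mul p n hnp
            · exact h4 _ hmul x
        _ = _ := by
            rw [hexp, mul_pow H, div_pow, mul_pow _ _ n, mul_pow A, ← pow_mul, ← pow_mul,
              ← pow_mul, e]
            field_simp
    · have hmul : r * p ≤ r * n := Nat.mul_le_mul_left r hnp
      have e : H ^ (r * n) = H ^ (r * n - r * p) * H ^ (r * p) := by
        rw [← pow_add, Nat.sub_add_cancel hmul]
      have hNp := hN.pos p
      have h7 := hb.le_mul p p le_rfl
      have h8 := h5 _ hmul x
      rw [Nat.sub_self, pow_zero, mul_one] at h7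
      rw [interp_mul hr hN, interp_mul hr hN] at h8
      calc M p * ‖iteratedDeriv (r * n) φ x‖
          ≤ (K * A ^ p * N p) * ((2 * C) ^ (r * n) * Real.exp (D * (p + 1)) *
              H ^ (r * n - r * p) * (N n / N p)) := by
            gcongr
        _ = _ := by
            rw [hexp, div_pow, mul_pow _ _ n, mul_pow A, ← pow_mul, ← pow_mul, ← pow_mul, e]
            field_simp
  · obtain ⟨K', hK'⟩ := h6 (h ^ (1 / (r : ℝ))) (Real.rpow_pos_of_pos hh _)
    refine ⟨K', fun n x => ?_⟩
    have := hK' (r * n) x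
    rwa [pow_mul, rpow_one_div_pow hh.le hr, interp_mul hr hN] at this

lemma bddAbove_range_div {f : ℕ → ℝ → ℝ} {h L : ℝ} {S : Set ℝ} (hN : IsLC N)
    (hh : 0 < h) (H : ∀ n, ∀ x ∈ S, f n x ≤ L * (h ^ n * N n)) :
    BddAbove (range fun q : ℕ × S => f q.1 q.2 / (h ^ q.1 * N q.1)) := by
  refine ⟨L, ?_⟩
  rintro _ ⟨⟨n, x⟩, rfl⟩
  have := hN.pos n
  exact (div_le_iff₀ (by positivity)).2 (H n x x.2)

/-- The size allowed for c p cancels the growth in p of the p-th block and leaves 2^{-p}. The blocks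
are pure monomials near 0, so the jet of the sum is read off directly. -/
theorem BlockData.exists_extension (hb : BlockData r M N ρ B C K A) (hr : 1 ≤ r) (hM : IsLC M)
    (hN : IsLC N) {D : ℝ} (hD : D = 4 * (r + 2 * B)) {H : ℕ → ℝ} (hH : ∀ p, 0 < H p)
    {H₀ : ℝ} (hH₀ : ∀ p, H p ≤ H₀) (hsupp : ∀ p : ℕ, D * (p + 1) ≤ H p * ρ p) {c : ℕ → ℂ} {K₀ : ℝ}
    (hc : ∀ p, ‖c p‖ ≤ K₀ * M p * (H p ^ r / (2 * (A * Real.exp D))) ^ p) :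
    ∃ f : ℝ → ℂ, f ∈ spaceD .roumieu r N 1 ∧ borelMap r univ f = c ∧
      (Tendsto H atTop (𝓝 0) → f ∈ spaceD .beurling r N 1) := by
  choose φ h1 h2 h3 h4 h5 using fun p => hb.exists_block hr hM hN hD (hH p) p (hsupp p)
  have hC0 : 0 < C := one_pos.trans_le hb.one_le_C
  have hA0 : 0 < A := one_pos.trans_le hb.one_le_A
  have hK0 : 0 < K := one_pos.trans_le hb.one_le_K
  have hK₀ : 0 ≤ K₀ := by
    have := (norm_nonneg _).trans (hc 0)
    simpa [hM.zero_eq_one] using this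
  set L := K₀ * (K * Real.exp D) with hL
  have hL0 : 0 ≤ L := by positivity
  let g : ℕ → ℝ → ℂ := fun p x => c p * φ p x
  have hg : ∀ p, ContDiff ℝ ∞ (g p) := fun p => contDiff_const.mul (h1 p)
  have hgd : ∀ p m x, iteratedDeriv m (g p) x = c p * iteratedDeriv m (φ p) x := fun p m x =>
    iteratedDeriv_const_mul (c p) ((h1 p).contDiffAt.of_le (by exact_mod_cast le_top))
  have hg0 : ∀ p x, 1 ≤ |x| → g p x = 0 := fun p x hx => by simp [g, h3 p x hx]
  have hgb : ∀ p n x, ‖iteratedDeriv (r * n) (g p) x‖ ≤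
      L * (1 / 2) ^ p * (((2 * C) ^ r * H p ^ r) ^ n * N n) := by
    intro p n x
    rw [hgd, norm_mul]
    have hHp := hH p
    calc ‖c p‖ * ‖iteratedDeriv (r * n) (φ p) x‖
        ≤ (K₀ * M p * (H p ^ r / (2 * (A * Real.exp D))) ^ p) *
          ‖iteratedDeriv (r * n) (φ p) x‖ := by gcongr; exact hc p
      _ = K₀ * (H p ^ r / (2 * (A * Real.exp D))) ^ p *
          (M p * ‖iteratedDeriv (r * n) (φ p) x‖) := by ring
      _ ≤ K₀ * (H p ^ r / (2 * (A * Real.exp D))) ^ p * (K * Real.exp D *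
          (((2 * C) ^ r * H p ^ r) ^ n * (A * Real.exp D / H p ^ r) ^ p * N n)) := by
          exact mul_le_mul_of_nonneg_left (h4 p n x) (by positivity)
      _ = L * ((H p ^ r / (2 * (A * Real.exp D))) ^ p * (A * Real.exp D / H p ^ r) ^ p) *
          (((2 * C) ^ r * H p ^ r) ^ n * N n) := by rw [hL]; ring
      _ = _ := by
          rw [← mul_pow]
          congr 3
          field_simp
  have hH₀0 : 0 < H₀ := (hH 0).trans_le (hH₀ 0)
  set h₀ := (2 * C) ^ r * H₀ ^ r with hh₀
  have hh₀0 : 0 < h₀ := by positivity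
  have hgb' : ∀ p n x, ‖iteratedDeriv (r * n) (g p) x‖ ≤ L * (1 / 2) ^ p * (h₀ ^ n * N n) := by
    intro p n x
    refine (hgb p n x).trans ?_
    have := hN.pos n
    have := hH p
    have := hH₀ p
    rw [hh₀]
    gcongr
  have hgeom : Summable fun p : ℕ => (1 / 2 : ℝ) ^ p := summable_geometric_two
  -- Only orders divisible by r are estimated directly; order k is reached from order rk ≥ k, at the
  -- cost 4^{rk-k}.
  obtain ⟨hf, hfs⟩ := contDiff_tsum_hasSum_iteratedDeriv hg
    (v := fun k p => 4 ^ (r * k - k) * (L * (1 / 2) ^ p * (h₀ ^ k * N k)))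
    (fun k => ((hgeom.mul_left L).mul_right _).mul_left _) fun k p x => by
      refine norm_iteratedDeriv_le_of_add (hg p) (hg0 p) (fun y => ?_) x
      rw [Nat.add_sub_cancel' (Nat.le_mul_of_pos_left k hr)]
      exact hgb' p k y
  set f : ℝ → ℂ := fun x => ∑' p, g p x with hfdef
  have hzero : ∀ p m, iteratedDeriv m (g p) 0 = if m = r * p then c p else 0 := fun p m => by
    rw [hgd, iteratedDeriv_zero_of_eventuallyEq_monomial (h2 p)]
    split_ifs <;> simp
  have hval : ∀ j, iteratedDeriv (r * j) f 0 = c j := fun j => by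
    refine (hfs (r * j) 0).unique ?_
    have : (fun p => iteratedDeriv (r * j) (g p) 0) = fun p => if p = j then c p else 0 := by
      funext p
      rw [hzero]
      have : r * j = r * p ↔ p = j := by
        rw [Nat.mul_left_cancel_iff (by omega)]; exact eq_comm
      simp only [this]
    rw [this]
    simpa using hasSum_ite_eq j (c j) |> fun h => by
      convert h using 2 with p
      split_ifs with hp <;> simp [hp]
  have hval0 : ∀ n j, 1 ≤ j → j < r → iteratedDeriv (r * n + j) f 0 = 0 := fun n j hj hjr => by
    refine (hfs (r * n + j) 0).unique ?_
    have : (fun p => iteratedDeriv (r * n + j) (g p) 0) = fun _ => 0 := by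
      funext p
      rw [hzero, if_neg]
      intro h
      have := congrArg (· % r) h
      simp [Nat.mod_eq_of_lt hjr] at this
      omega
    rw [this]
    exact hasSum_zero
  have hts : tsupport f ⊆ Icc (-1) 1 := by
    refine closure_minimal (fun x hx => ?_) isClosed_Icc
    by_contra hx'
    refine hx ?_
    have : 1 ≤ |x| := by
      by_contra! h
      exact hx' ⟨(abs_lt.1 h).1.le, (abs_lt.1 h).2.le⟩
    simp [f, hg0 _ x this]
  have hbound : ∀ (h : ℝ) (τ : ℕ → ℝ), Summable τ →
      (∀ p n x, ‖iteratedDeriv (r * n) (g p) x‖ ≤ τ p * (h ^ n * N n)) →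
      ∀ n x, ‖iteratedDeriv (r * n) f x‖ ≤ (∑' p, τ p) * (h ^ n * N n) := by
    intro h τ hτ hτb n x
    rw [← (hfs (r * n) x).tsum_eq, ← tsum_mul_right]
    exact tsum_of_norm_bounded (hτ.mul_right _).hasSum fun p => hτb p n x
  refine ⟨f, ⟨⟨hf.contDiffOn, ?_, h₀, hh₀0, ?_⟩, hts⟩, ?_,
    fun hlim => ⟨⟨hf.contDiffOn, ?_, ?_⟩, hts⟩⟩
  · simpa [iteratedDerivWithin_univ] using hval0
  · simp only [iteratedDerivWithin_univ]
    exact bddAbove_range_div hN hh₀0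
      (f := fun n x => ‖iteratedDeriv (r * n) f x‖)
      fun n x _ => hbound h₀ _ (hgeom.mul_left L) hgb' n x
  · funext j
    simp [borelMap, iteratedDerivWithin_univ, hval]
  · simpa [iteratedDerivWithin_univ] using hval0
  · intro h hh
    simp only [iteratedDerivWithin_univ]
    have hlim2 : Tendsto (fun p => (2 * C) ^ r * H p ^ r) atTop (𝓝 0) := by
      have := (hlim.pow r).const_mul ((2 * C) ^ r)
      simpa [show r ≠ 0 by omega] using this
    obtain ⟨P, hP⟩ := eventually_atTop.1 (hlim2.eventually (gt_mem_nhds hh))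
    choose K' hK' using fun p => h5 p h hh
    have hK'0 : ∀ p, 0 ≤ K' p := fun p => by
      simpa [hN.zero_eq_one] using (norm_nonneg _).trans (hK' p 0 0)
    -- From P on, H p is small enough for the given h; the finitely many earlier blocks satisfy the
    -- h-bound with constants of their own.
    let τ : ℕ → ℝ := fun p => L * (1 / 2) ^ p + if p < P then ‖c p‖ * K' p else 0
    have hτ : Summable τ := (hgeom.mul_left L).add
      (summable_of_ne_finset_zero (s := Finset.range P) fun p hp => by simp at hp; simp [hp])
    refine bddAbove_range_div hN hh
      (f := fun n x => ‖iteratedDeriv (r * n) f x‖)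
      fun n x _ => hbound h τ hτ (fun p n x => ?_) n x
    have hNn := hN.pos n
    simp only [τ]
    split_ifs with hpP
    · rw [hgd, norm_mul]
      have h7 : ‖c p‖ * ‖iteratedDeriv (r * n) (φ p) x‖ ≤ ‖c p‖ * (K' p * h ^ n * N n) := by
        gcongr; exact hK' p n x
      have : 0 ≤ L * (1 / 2) ^ p * (h ^ n * N n) := by positivity
      nlinarith
    · refine (hgb p n x).trans ?_
      rw [add_zero]
      have := hH p
      have := (hP p (by omega)).le
      gcongr

end Surjectivity

/-! ### The growth condition and the choice of the parameters H -/

lemma rootQuot_nonneg {r : ℕ} {M : ℕ → ℝ} (hM : IsLC M) (p : ℕ) : 0 ≤ rootQuot r M p :=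
  Real.rpow_nonneg (div_nonneg (Real.rpow_nonneg (hM.pos p).le _) (by positivity)) _

lemma rootQuot_pow {r : ℕ} {M : ℕ → ℝ} (hM : IsLC M) {p : ℕ} (hp : 1 ≤ p) :
    rootQuot r M p ^ p * p.factorial = M p ^ (1 / (r : ℝ)) := by
  have h : 0 ≤ M p ^ (1 / (r : ℝ)) / (p.factorial : ℝ) :=
    div_nonneg (Real.rpow_nonneg (hM.pos p).le _) (by positivity)
  rw [rootQuot, rpow_one_div_pow h hp, div_mul_cancel₀]
  exact_mod_cast p.factorial_ne_zero

lemma pow_self_le_exp_mul_factorial (p : ℕ) : (p : ℝ) ^ p ≤ Real.exp 1 ^ p * p.factorial := by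
  have h := Real.pow_div_factorial_le_exp (p : ℝ) (Nat.cast_nonneg p) p
  rwa [div_le_iff₀ (by positivity), ← mul_one (p : ℝ), Real.exp_nat_mul, mul_one] at h

/-- The Roumieu growth condition as a lower bound. -/
lemma exists_le_rootQuot {r : ℕ} {M : ℕ → ℝ} (h : GrowthCondition .roumieu r M) :
    ∃ c, 0 < c ∧ ∀ᶠ p in atTop, c ≤ rootQuot r M p := by
  obtain ⟨c, -, hc0, hc⟩ := ENNReal.lt_iff_exists_real_btwn.1 h
  refine ⟨c, ENNReal.ofReal_pos.1 hc0, ?_⟩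
  filter_upwards [eventually_lt_of_lt_liminf hc] with p hp
  exact (ENNReal.ofReal_lt_ofReal_iff_of_nonneg (ENNReal.ofReal_pos.1 hc0).le).1 hp |>.le

section Surjectivity

variable {r : ℕ} {M N ρ : ℕ → ℝ} {B C K A : ℝ}

/-- The case n = 0 of `le_mul` bounds M_p by a power of ρ_p, and p^p ≤ e^p p! converts factorials.
Thus growth of M over factorials forces p/ρ_p to be bounded, or to tend to 0. -/
lemma BlockData.rootQuot_mul_le (hb : BlockData r M N ρ B C K A) (hr : 1 ≤ r) (hM : IsLC M)
    (hN : IsLC N) {p : ℕ} (hp : 1 ≤ p) :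
    rootQuot r M p * (p + 1) ≤ 2 * Real.exp 1 * (K * A) * ρ p := by
  have hρ := hb.pos p
  have hA := hb.one_le_A
  have hK := hb.one_le_K
  have ht := rootQuot_nonneg (r := r) hM p
  have h1 : M p ^ (1 / (r : ℝ)) ≤ (K * A * ρ p) ^ p := by
    refine le_of_pow_le_pow_left₀ (n := r) (by omega) (by positivity) ?_
    rw [rpow_one_div_pow (hM.pos p).le hr]
    have h2 := hb.le_mul p 0 (Nat.zero_le p)
    rw [hN.zero_eq_one, mul_one, mul_zero, Nat.sub_zero] at h2
    refine h2.trans ?_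
    have h3 : K * A ^ p ≤ ((K * A) ^ p) ^ r := by
      have h4 : K * A ^ p ≤ (K * A) ^ p := by
        rw [mul_pow]
        gcongr
        exact le_self_pow₀ hK (by omega)
      exact h4.trans (le_self_pow₀ (one_le_pow₀ (one_le_mul_of_one_le_of_one_le hK hA)) (by omega))
    rw [mul_pow (K * A), mul_pow _ _ r, ← pow_mul (ρ p), mul_comm p r]
    gcongr
  rw [← rootQuot_pow hM hp] at h1
  have h2 : rootQuot r M p * p ≤ Real.exp 1 * (K * A) * ρ p := by
    refine le_of_pow_le_pow_left₀ (n := p) (by omega) (by positivity) ?_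
    calc (rootQuot r M p * p) ^ p = rootQuot r M p ^ p * (p : ℝ) ^ p := mul_pow _ _ _
      _ ≤ rootQuot r M p ^ p * (Real.exp 1 ^ p * p.factorial) := by
          gcongr; exact pow_self_le_exp_mul_factorial p
      _ = Real.exp 1 ^ p * (rootQuot r M p ^ p * p.factorial) := by ring
      _ ≤ Real.exp 1 ^ p * (K * A * ρ p) ^ p := by gcongr
      _ = _ := by rw [← mul_pow]; ring
  have h3 : (1 : ℝ) ≤ p := by exact_mod_cast hp
  nlinarith

theorem seqSpace_subset_of_SV {t : UltraType} (hr : 1 ≤ r) (hM : IsLC M)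
    (hN : IsLC N) (hgrowth : GrowthCondition t r M) (hMN : Preceq M N) (h : SV r M N) :
    seqSpace t M ⊆ borelMap r univ '' spaceD t r N 1 := by
  obtain ⟨ρ, B, C, K, A, hb⟩ := exists_blockData hr hM hN hMN h
  have hA := hb.one_le_A
  have hK := hb.one_le_K
  have hB := hb.nonneg_B
  obtain ⟨D, hD⟩ : ∃ D, D = 4 * ((r : ℝ) + 2 * B) := ⟨_, rfl⟩
  have hD0 : 0 ≤ D := by rw [hD]; positivity
  set b := 2 * (A * Real.exp D) with hbdef
  have hb0 : 0 < b := by positivity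
  have hr' : r ≠ 0 := by omega
  let σ : ℕ → ℝ := fun p => D * (p + 1) / ρ p
  have hσ0 : ∀ p, 0 ≤ σ p := fun p => by have := hb.pos p; positivity
  have hσ : ∀ p, 1 ≤ p → ∀ y, 0 < y → y ≤ rootQuot r M p →
      σ p ≤ D * (2 * Real.exp 1 * (K * A)) / y := by
    intro p hp y hy hyp
    have h1 := hb.rootQuot_mul_le hr hM hN hp
    have h2 : y * (p + 1) ≤ 2 * Real.exp 1 * (K * A) * ρ p := le_trans (by gcongr) h1
    simp only [σ]
    rw [div_le_div_iff₀ (hb.pos p) hy]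
    nlinarith
  have hsuppσ : ∀ (p : ℕ) (y : ℝ), σ p ≤ y → D * (p + 1) ≤ y * ρ p := fun p y hy =>
    (div_le_iff₀ (hb.pos p)).1 hy
  cases t with
  | roumieu =>
    rintro a ⟨h, hh, ⟨K₀, hK₀⟩⟩
    obtain ⟨c, hc, hcev⟩ := exists_le_rootQuot hgrowth
    obtain ⟨σ₀, hσ₀⟩ : BddAbove (range σ) := by
      refine IsBoundedUnder.bddAbove_range ⟨D * (2 * Real.exp 1 * (K * A)) / c, ?_⟩
      rw [eventually_map]
      filter_upwards [hcev, eventually_ge_atTop 1] with p hp hp1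
      exact hσ p hp1 c hc hp
    have hσ₀' : ∀ p, σ p ≤ σ₀ := fun p => hσ₀ (mem_range_self p)
    -- The entry σ₀ keeps the supports in [-1,1], the entry b * h admits the coefficients, and H ≥ 1
    -- gives H ≤ H^r.
    let H := max 1 (max σ₀ (b * h))
    have hH1 : 1 ≤ H := le_max_left _ _
    obtain ⟨f, hf, hfa, -⟩ := hb.exists_extension hr hM hN hD (H := fun _ => H) (H₀ := H)
      (fun _ => by linarith) (fun _ => le_rfl)
      (fun p => hsuppσ p H ((hσ₀' p).trans ((le_max_left _ _).trans (le_max_right _ _))))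
      (c := a) (K₀ := K₀) fun p => by
        have hMp := hM.pos p
        have h1 : ‖a p‖ / (h ^ p * M p) ≤ K₀ := hK₀ (mem_range_self p)
        rw [div_le_iff₀ (by positivity)] at h1
        have hK₀0 : 0 ≤ K₀ := le_trans (by positivity) (hK₀ (mem_range_self p))
        have h2 : h ≤ H ^ r / b := by
          rw [le_div_iff₀ hb0, mul_comm]
          exact ((le_max_right _ _).trans (le_max_right _ _)).trans (le_self_pow₀ hH1 hr')
        calc ‖a p‖ ≤ K₀ * (h ^ p * M p) := h1
          _ = K₀ * M p * h ^ p := by ring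
          _ ≤ _ := by gcongr
    exact ⟨f, hf, hfa⟩
  | beurling =>
    intro a ha
    have hσlim : Tendsto σ atTop (𝓝 0) := by
      have h1 : Tendsto (fun p => D * (2 * Real.exp 1 * (K * A)) / rootQuot r M p) atTop (𝓝 0) :=
        Tendsto.div_atTop tendsto_const_nhds hgrowth
      refine tendsto_of_tendsto_of_tendsto_of_le_of_le' tendsto_const_nhds h1
        (Eventually.of_forall hσ0) ?_
      have hg : Tendsto (rootQuot r M) atTop atTop := hgrowth
      filter_upwards [hg.eventually_gt_atTop 0, eventually_ge_atTop 1] with p hp hp1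
      exact hσ p hp1 _ hp le_rfl
    let y : ℕ → ℝ := fun p => (‖a p‖ / M p) ^ (1 / (p : ℝ))
    have hy0 : ∀ p, 0 ≤ y p := fun p =>
      Real.rpow_nonneg (div_nonneg (norm_nonneg _) (hM.pos p).le) _
    have hyp : ∀ p, 1 ≤ p → y p ^ p = ‖a p‖ / M p := fun p hp =>
      rpow_one_div_pow (div_nonneg (norm_nonneg _) (hM.pos p).le) hp
    have hylim : Tendsto y atTop (𝓝 0) := by
      rw [Metric.tendsto_atTop']
      intro ε hε
      obtain ⟨K₀, hK₀⟩ := ha (ε / 4) (by positivity)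
      obtain ⟨P, hP⟩ := pow_unbounded_of_one_lt K₀ (one_lt_two : (1 : ℝ) < 2)
      refine ⟨P, fun p hp => ?_⟩
      rw [dist_zero_right, Real.norm_of_nonneg (hy0 p)]
      have h1 : ‖a p‖ / ((ε / 4) ^ p * M p) ≤ K₀ := hK₀ (mem_range_self p)
      have hMp := hM.pos p
      have h2 : K₀ ≤ 2 ^ p := hP.le.trans (pow_le_pow_right₀ one_le_two (le_of_lt hp))
      have h3 : y p ^ p ≤ (ε / 2) ^ p := by
        rw [hyp p (by omega), div_le_iff₀ hMp]
        rw [div_le_iff₀ (by positivity)] at h1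
        calc ‖a p‖ ≤ K₀ * ((ε / 4) ^ p * M p) := h1
          _ ≤ 2 ^ p * ((ε / 4) ^ p * M p) := by gcongr
          _ = _ := by rw [← mul_assoc, ← mul_pow]; ring
      have := le_of_pow_le_pow_left₀ (by omega) (by positivity) h3
      linarith
    -- The first entry only ensures positivity, the second the support, the third the coefficient
    -- bound; all three tend to 0.
    let H : ℕ → ℝ := fun p => max (1 / ((p : ℝ) + 1)) (max (σ p) ((b * y p) ^ (1 / (r : ℝ))))
    have hH0 : ∀ p, 0 < H p := fun p => lt_max_of_lt_left (by positivity)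
    have hHlim : Tendsto H atTop (𝓝 0) := by
      have h1 : Tendsto (fun p => (b * y p) ^ (1 / (r : ℝ))) atTop (𝓝 0) := by
        have := (hylim.const_mul b).rpow_const (p := 1 / (r : ℝ)) (Or.inr (by positivity))
        rwa [mul_zero, Real.zero_rpow (by positivity)] at this
      have h2 := (tendsto_one_div_add_atTop_nhds_zero_nat (𝕜 := ℝ)).max (hσlim.max h1)
      rwa [max_self, max_self] at h2
    obtain ⟨H₀, hH₀⟩ := hHlim.bddAbove_range
    obtain ⟨f, -, hfa, hf⟩ := hb.exists_extension hr hM hN hD (H := H) (H₀ := H₀)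
      hH0 (fun p => hH₀ (mem_range_self p))
      (fun p => hsuppσ p _ ((le_max_left _ _).trans (le_max_right _ _)))
      -- The p-th root carries no information on a 0, so that entry is put into the constant.
      (c := a) (K₀ := max 1 ‖a 0‖) fun p => by
        have hMp := hM.pos p
        rcases Nat.eq_zero_or_pos p with rfl | hp
        · simp [hM.zero_eq_one]
        · have h1 : y p ≤ H p ^ r / b := by
            rw [le_div_iff₀ hb0, mul_comm]
            have h2 : 0 ≤ b * y p := mul_nonneg hb0.le (hy0 p)
            rw [← rpow_one_div_pow h2 hr]
            exact pow_le_pow_left₀ (Real.rpow_nonneg h2 _)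
              ((le_max_right _ _).trans (le_max_right _ _)) r
          have h3 : ‖a p‖ = M p * y p ^ p := by rw [hyp p hp]; field_simp
          rw [h3]
          have := hy0 p
          calc M p * y p ^ p ≤ M p * (H p ^ r / b) ^ p := by gcongr
            _ = 1 * (M p * (H p ^ r / b) ^ p) := by ring
            _ ≤ max 1 ‖a 0‖ * (M p * (H p ^ r / b) ^ p) := by
                have := hH0 p
                gcongr
                exact le_max_left _ _
            _ = _ := by ring
    exact ⟨f, hf hHlim, hfa⟩

end Surjectivity

/-! ### Towers of derivatives -/

/-- `G (m + 1)` is the derivative of `G m` on `s`. -/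
def IsTower (G : ℕ → ℝ → ℂ) (s : Set ℝ) : Prop :=
  ∀ m, ∀ x ∈ s, HasDerivWithinAt (G m) (G (m + 1) x) s x

namespace IsTower

variable {G : ℕ → ℝ → ℂ} {s t : Set ℝ}

lemma mono (h : IsTower G t) (hst : s ⊆ t) : IsTower G s :=
  fun m x hx => (h m x (hst hx)).mono hst

lemma shift (h : IsTower G s) (k : ℕ) : IsTower (fun m => G (k + m)) s :=
  fun m x hx => h (k + m) x hx

lemma reflect {a b : ℝ} (h : IsTower G (Icc a b)) :
    IsTower (fun m y => (-1) ^ m * G m (-y)) (Icc (-b) (-a)) := by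
  intro m x hx
  have h1 := (h m (-x) ⟨by linarith [hx.2], by linarith [hx.1]⟩).scomp x
    ((hasDerivAt_neg x).hasDerivWithinAt (s := Icc (-b) (-a)))
    (fun y hy => ⟨by linarith [hy.2], by linarith [hy.1]⟩)
  have h2 := h1.const_mul ((-1 : ℂ) ^ m)
  have e : (-1 : ℂ) ^ (m + 1) * G (m + 1) (-x) = (-1 : ℂ) ^ m * ((-1 : ℝ) • G (m + 1) (-x)) := by
    rw [pow_succ]; simp
  change HasDerivWithinAt (fun y => (-1) ^ m * G m (-y)) ((-1) ^ (m + 1) * G (m + 1) (-x)) _ _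
  rw [e]
  exact h2

theorem taylor {a b C : ℝ} {k : ℕ} (h : IsTower G (Icc a b))
    (hC : ∀ y ∈ Icc a b, ‖G k y‖ ≤ C) {x : ℝ} (hx : x ∈ Icc a b) :
    ‖G 0 x - ∑ i ∈ Finset.range k, monomial i (x - a) * G i a‖ ≤
      C * ((x - a) ^ k / k.factorial) := by
  induction k generalizing G x with
  | zero => simpa using hC x hx
  | succ k ih =>
    have hd : ∀ y, HasDerivAt (fun y => ∑ i ∈ Finset.range (k + 1), monomial i (y - a) * G i a)
        (∑ i ∈ Finset.range k, monomial i (y - a) * G (1 + i) a) y := by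
      intro y
      simp only [Finset.sum_range_succ' _ k]
      have h0 : ∀ y, monomial 0 (y - a) * G 0 a = G 0 a := fun y => by simp [monomial]
      simp only [h0]
      refine HasDerivAt.add_const _ (HasDerivAt.fun_sum fun i _ => ?_)
      rw [add_comm 1 i]
      exact ((hasDerivAt_monomial_succ i (y - a)).comp_sub_const y a).mul_const _
    have hB : ∀ y, HasDerivAt (fun y => C * ((y - a) ^ (k + 1) / (k + 1).factorial))
        (C * ((y - a) ^ k / k.factorial)) y := by
      intro y
      have h1 := ((((hasDerivAt_id y).sub_const a).pow (k + 1)).div_const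
        ((k + 1).factorial : ℝ)).const_mul C
      have e : (y - a) ^ k / (k.factorial : ℝ) =
          ((k + 1 : ℕ) : ℝ) * (y - a) ^ (k + 1 - 1) * 1 / ((k + 1).factorial : ℝ) := by
        rw [Nat.factorial_succ, Nat.add_sub_cancel]
        push_cast
        have : (k.factorial : ℝ) ≠ 0 := by positivity
        field_simp
      rw [e]
      exact h1
    refine image_norm_le_of_norm_deriv_right_le_deriv_boundary (a := a) (b := b)
      (f := fun x => G 0 x - ∑ i ∈ Finset.range (k + 1), monomial i (x - a) * G i a)
      (f' := fun x => G 1 x - ∑ i ∈ Finset.range k, monomial i (x - a) * G (1 + i) a)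
      (B := fun x => C * ((x - a) ^ (k + 1) / (k + 1).factorial)) ?_ ?_ ?_ hB ?_ hx
    · intro y hy
      exact ((h 0 y hy).sub (hd y).hasDerivWithinAt).continuousWithinAt
    · intro y hy
      have h1 := (h 0 y ⟨hy.1, hy.2.le⟩).sub (hd y).hasDerivWithinAt
      exact h1.mono_of_mem_nhdsWithin (Icc_mem_nhdsGE_of_mem hy)
    · simp only [sub_self]
      rw [Finset.sum_range_succ']
      simp [monomial]
    · intro y hy
      exact ih (h.shift 1) (fun z hz => by rw [add_comm]; exact hC z hz) ⟨hy.1, hy.2.le⟩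

end IsTower

/-! ### Bounds for intermediate derivatives -/

/-- By Taylor's formula the polynomial of degree below r is bounded by A₀ + A₁ d^r at the nodes x +
kd/r. Inverting the Vandermonde matrix of the k/r recovers its coefficients with a constant
depending on r only. -/
lemma exists_landau_const (r : ℕ) : ∃ L : ℝ, 0 ≤ L ∧ ∀ (G : ℕ → ℝ → ℂ) (x d A₀ A₁ : ℝ), 0 ≤ d →
    IsTower G (Icc x (x + d)) → (∀ y ∈ Icc x (x + d), ‖G 0 y‖ ≤ A₀) →
    (∀ y ∈ Icc x (x + d), ‖G r y‖ ≤ A₁) → ∀ j < r, d ^ j * ‖G j x‖ ≤ L * (A₀ + A₁ * d ^ r) := by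
  let v : Fin r → ℂ := fun k => (((k : ℕ) / r : ℝ) : ℂ)
  let V := Matrix.vandermonde v
  have hv : Function.Injective v := by
    intro k l hkl
    have hr : (r : ℝ) ≠ 0 := by exact_mod_cast (k.pos).ne'
    simp only [v, Complex.ofReal_inj] at hkl
    rw [div_left_inj' hr] at hkl
    exact Fin.ext (by exact_mod_cast hkl)
  have hV : IsUnit V.det := (Matrix.det_vandermonde_ne_zero_iff.2 hv).isUnit
  let L₀ : ℝ := ∑ i, ∑ k, ‖V⁻¹ i k‖
  refine ⟨r.factorial * L₀, by positivity, fun G x d A₀ A₁ hd hG h0 h1 j hj => ?_⟩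
  have hA₁ : 0 ≤ A₁ := (norm_nonneg _).trans (h1 x ⟨le_rfl, by linarith⟩)
  let c : Fin r → ℂ := fun i => monomial i d * G i x
  have hP : ∀ k, ‖(V.mulVec c) k‖ ≤ A₀ + A₁ * d ^ r := by
    intro k
    have hr : (0 : ℝ) < r := by exact_mod_cast k.pos
    have ht0 : (0 : ℝ) ≤ (k : ℕ) / r := by positivity
    have ht1 : ((k : ℕ) / r : ℝ) ≤ 1 := (div_le_one hr).2 (by exact_mod_cast k.2.le)
    have hy : x + (k : ℕ) / r * d ∈ Icc x (x + d) :=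
      ⟨by nlinarith, by nlinarith⟩
    have h2 := hG.taylor h1 hy
    have e : ∑ i ∈ Finset.range r, monomial i (x + (k : ℕ) / r * d - x) * G i x =
        V.mulVec c k := by
      rw [← Fin.sum_univ_eq_sum_range (fun i => monomial i (x + (k : ℕ) / r * d - x) * G i x)]
      refine Finset.sum_congr rfl fun i _ => ?_
      simp only [V, Matrix.vandermonde_apply, c, v, monomial]
      push_cast
      rw [add_sub_cancel_left, mul_pow]
      ring
    rw [e] at h2
    have h3 : A₁ * ((x + (k : ℕ) / r * d - x) ^ r / r.factorial) ≤ A₁ * d ^ r := by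
      refine mul_le_mul_of_nonneg_left ?_ hA₁
      rw [add_sub_cancel_left]
      calc ((k : ℕ) / r * d : ℝ) ^ r / r.factorial ≤ ((k : ℕ) / r * d : ℝ) ^ r :=
            div_le_self (by positivity) (by exact_mod_cast Nat.factorial_pos r)
        _ ≤ d ^ r := pow_le_pow_left₀ (by positivity) (mul_le_of_le_one_left hd ht1) r
    have h4 := norm_sub_norm_le (V.mulVec c k) (G 0 (x + (k : ℕ) / r * d))
    rw [norm_sub_rev] at h4
    linarith [h0 _ hy]
  have hc : c = V⁻¹.mulVec (V.mulVec c) := by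
    rw [Matrix.mulVec_mulVec, Matrix.nonsing_inv_mul _ hV, Matrix.one_mulVec]
  set X := A₀ + A₁ * d ^ r with hX
  have hX0 : 0 ≤ X := (norm_nonneg _).trans (hP ⟨j, hj⟩)
  have hcj : ‖c ⟨j, hj⟩‖ ≤ L₀ * X := by
    rw [hc]
    calc ‖∑ k, V⁻¹ ⟨j, hj⟩ k * V.mulVec c k‖ ≤ ∑ k, ‖V⁻¹ ⟨j, hj⟩ k‖ * X := by
          refine (norm_sum_le _ _).trans (Finset.sum_le_sum fun k _ => ?_)
          rw [norm_mul]
          exact mul_le_mul_of_nonneg_left (hP k) (norm_nonneg _)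
      _ = (∑ k, ‖V⁻¹ ⟨j, hj⟩ k‖) * X := by rw [Finset.sum_mul]
      _ ≤ L₀ * X := by
          refine mul_le_mul_of_nonneg_right ?_ hX0
          exact Finset.single_le_sum (f := fun i => ∑ k, ‖V⁻¹ i k‖) (fun i _ => by positivity)
            (Finset.mem_univ (⟨j, hj⟩ : Fin r))
  simp only [c, norm_mul, norm_monomial, abs_of_nonneg hd] at hcj
  have hjf : (0 : ℝ) < j.factorial := by positivity
  have hle : (j.factorial : ℝ) ≤ r.factorial := by exact_mod_cast Nat.factorial_le hj.le
  calc d ^ j * ‖G j x‖ = j.factorial * (d ^ j / j.factorial * ‖G j x‖) := by field_simp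
    _ ≤ r.factorial * (L₀ * X) := by gcongr
    _ = _ := by ring

/-- The Landau inequality between orders rn and r(n+1), at the scale set by the common quotient of
`interp` in that range, fills in the orders not divisible by r. -/
theorem exists_intermediate_bound {r : ℕ} (hr : 1 ≤ r) {N : ℕ → ℝ} (hN : IsLC N) :
    ∃ L : ℝ, 1 ≤ L ∧ ∀ (G : ℕ → ℝ → ℂ) (K h : ℝ), 1 ≤ h → IsTower G (Icc 0 1) →
      (∀ n, ∀ x ∈ Icc (0 : ℝ) 1, ‖G (r * n) x‖ ≤ K * h ^ n * N n) →
      ∀ m, ∀ x ∈ Icc (0 : ℝ) 1, ‖G m x‖ ≤ L * (1 + h) * K * h ^ m * interp r N m := by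
  obtain ⟨L, hL, hLb⟩ := exists_landau_const r
  have hmax := le_max_left 1 (2 ^ r * L)
  refine ⟨max 1 (2 ^ r * L), hmax, fun G K h hh hG hb m x hx => ?_⟩
  obtain ⟨n, j, hj, rfl⟩ : ∃ n j, j < r ∧ m = r * n + j :=
    ⟨m / r, m % r, Nat.mod_lt _ hr, (Nat.div_add_mod m r).symm⟩
  have hK : 0 ≤ K := by
    simpa [hN.zero_eq_one] using (norm_nonneg _).trans (hb 0 0 (by simp))
  set q := step r N (r * n) with hq
  have hq1 : 1 ≤ q := one_le_step hN _
  have hqr : N n * q ^ r = N (n + 1) := by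
    rw [hq, step_pow hr hN, Nat.mul_div_cancel_left n hr, hN.mul_quot]
  have hNn := hN.pos n
  -- Of order 1/q, so that N (n+1) d^r ≤ N n, and at most 1/2, so that an interval of length d on
  -- one side of x lies in [0,1]; the left side is reduced to the right by reflection.
  set d := 1 / (2 * q) with hd
  have hd0 : 0 < d := by positivity
  have hd1 : d ≤ 1 / 2 := by
    rw [hd]
    exact one_div_le_one_div_of_le (by norm_num) (by linarith)
  have hdq : d * q = 1 / 2 := by rw [hd]; field_simp
  have key : d ^ j * ‖G (r * n + j) x‖ ≤
      L * (K * h ^ n * N n + K * h ^ (n + 1) * N (n + 1) * d ^ r) := by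
    rcases le_total x (1 / 2) with hx2 | hx2
    · have hsub : Icc x (x + d) ⊆ Icc 0 1 := Icc_subset_Icc hx.1 (by linarith)
      exact hLb (fun m => G (r * n + m)) x d _ _ hd0.le ((hG.mono hsub).shift _)
        (fun y hy => hb n y (hsub hy)) (fun y hy => hb (n + 1) y (hsub hy)) j hj
    · have hsub : Icc (x - d) x ⊆ Icc 0 1 := Icc_subset_Icc (by linarith) hx.2
      have hn : ∀ (m : ℕ) (z : ℂ), ‖(-1) ^ m * z‖ = ‖z‖ := fun m z => by simp
      have h1 := ((hG.mono hsub).shift (r * n)).reflect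
      have e : -(x - d) = -x + d := by ring
      rw [e] at h1
      have hmem : ∀ y ∈ Icc (-x) (-x + d), -y ∈ Icc (0 : ℝ) 1 := fun y hy =>
        hsub ⟨by linarith [hy.2], by linarith [hy.1]⟩
      have := hLb _ (-x) d (K * h ^ n * N n) (K * h ^ (n + 1) * N (n + 1)) hd0.le h1
        (fun y hy => by rw [hn]; exact hb n _ (hmem y hy))
        (fun y hy => by rw [hn]; exact hb (n + 1) _ (hmem y hy)) j hj
      simpa [hn] using this
  have hdr : N (n + 1) * d ^ r ≤ N n := by
    rw [← hqr, mul_assoc, ← mul_pow, mul_comm q, hdq]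
    exact mul_le_of_le_one_right hNn.le (pow_le_one₀ (by norm_num) (by norm_num))
  have key2 : d ^ j * ‖G (r * n + j) x‖ ≤ L * (1 + h) * K * h ^ n * N n := by
    refine key.trans ?_
    calc L * (K * h ^ n * N n + K * h ^ (n + 1) * N (n + 1) * d ^ r)
        = L * (K * h ^ n * N n + K * h ^ (n + 1) * (N (n + 1) * d ^ r)) := by ring
      _ ≤ L * (K * h ^ n * N n + K * h ^ (n + 1) * N n) := by gcongr
      _ = _ := by ring
  have hdj : (2 * q) ^ j * d ^ j = 1 := by rw [← mul_pow, hd]; field_simp; simp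
  have hpow : h ^ n ≤ h ^ (r * n + j) :=
    pow_le_pow_right₀ hh (le_add_right (Nat.le_mul_of_pos_left n hr))
  have h2j : (2 : ℝ) ^ j ≤ 2 ^ r := pow_le_pow_right₀ one_le_two hj.le
  rw [interp_add_of_le n hj.le, interp_mul hr hN, ← hq]
  calc ‖G (r * n + j) x‖ = (2 * q) ^ j * (d ^ j * ‖G (r * n + j) x‖) := by
        rw [← mul_assoc, hdj, one_mul]
    _ ≤ (2 * q) ^ j * (L * (1 + h) * K * h ^ n * N n) := by gcongr
    _ = (2 ^ j * L) * (1 + h) * K * h ^ n * (N n * q ^ j) := by rw [mul_pow]; ring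
    _ ≤ max 1 (2 ^ r * L) * (1 + h) * K * h ^ (r * n + j) * (N n * q ^ j) := by
        gcongr
        exact le_trans (by gcongr) (le_max_right _ _)

/-! ### Bang's estimate -/

section Bang

variable {r : ℕ} {N : ℕ → ℝ} {G : ℕ → ℝ → ℂ} {K h : ℝ}

/-- With y = e h q_l (x - a) ≤ 1, where q_l = `step r N l`, Taylor's formula at a is dominated by
the exponential series of y, so moving this far costs only one factor e. -/
lemma IsTower.bang_step (hN : IsLC N) (hK : 0 ≤ K) (hh : 0 < h) {a b : ℝ} {l : ℕ}
    (hG : IsTower G (Icc a b)) (hb : ∀ m, ∀ x ∈ Icc a b, ‖G m x‖ ≤ K * h ^ m * interp r N m)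
    (ha : ∀ m, ‖G m a‖ ≤ K * h ^ m * interp r N m * (Real.exp 1 ^ m / Real.exp 1 ^ (l + 1)))
    (hab : b - a ≤ 1 / (Real.exp 1 * h * step r N l)) (m : ℕ) {x : ℝ} (hx : x ∈ Icc a b) :
    ‖G m x‖ ≤ K * h ^ m * interp r N m * (Real.exp 1 ^ m / Real.exp 1 ^ l) := by
  set E := Real.exp 1 with hE
  have hE1 : 1 ≤ E := Real.one_le_exp zero_le_one
  have hPm := interp_pos (r := r) hN m
  have hql := step_pos (r := r) hN l
  rcases le_or_gt l m with hlm | hml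
  · refine (hb m x hx).trans (le_mul_of_one_le_right (by positivity) ?_)
    rw [one_le_div (by positivity)]
    exact pow_le_pow_right₀ hE1 hlm
  -- The expansion stops at order l + 1, where the weight e^{m+k-(l+1)} is 1: the remainder, known
  -- only through the unweighted bound, then fits the pattern of the other terms.
  obtain ⟨k, hk⟩ := Nat.exists_eq_add_of_le (show m ≤ l + 1 by omega)
  have hxa : 0 ≤ x - a := by linarith [hx.1]
  have hT := (hG.shift m).taylor (k := k) (fun y hy => hb (m + k) y hy) hx
  simp only [add_zero] at hT
  set Y := K * h ^ m * interp r N m * (E ^ m / E ^ (l + 1)) with hY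
  have hY0 : 0 ≤ Y := by positivity
  set y := E * h * step r N l * (x - a) with hy
  have hy0 : 0 ≤ y := by positivity
  have hy1 : y ≤ 1 := by
    have h1 : x - a ≤ 1 / (E * h * step r N l) := by linarith [hx.2]
    rw [le_div_iff₀ (by positivity)] at h1
    rw [hy]; linarith
  have hterm : ∀ i ≤ k, K * h ^ (m + i) * interp r N (m + i) * (E ^ (m + i) / E ^ (l + 1)) *
      ((x - a) ^ i / i.factorial) ≤ Y * (y ^ i / i.factorial) := by
    intro i hi
    have h1 := interp_add_le (r := r) hN (show m + i ≤ l + 1 by omega)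
    calc _ ≤ K * h ^ (m + i) * (interp r N m * step r N l ^ i) * (E ^ (m + i) / E ^ (l + 1)) *
          ((x - a) ^ i / i.factorial) := by gcongr
      _ = _ := by rw [hY, hy, mul_pow, mul_pow, mul_pow, pow_add, pow_add]; ring
  have hsum : ‖∑ i ∈ Finset.range k, monomial i (x - a) * G (m + i) a‖ ≤
      ∑ i ∈ Finset.range k, Y * (y ^ i / i.factorial) := by
    refine (norm_sum_le _ _).trans (Finset.sum_le_sum fun i hi => ?_)
    refine le_trans ?_ (hterm i (Finset.mem_range.1 hi).le)
    rw [norm_mul, norm_monomial, abs_of_nonneg hxa, mul_comm]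
    exact mul_le_mul_of_nonneg_right (ha _) (by positivity)
  have hlast : K * h ^ (m + k) * interp r N (m + k) * ((x - a) ^ k / k.factorial) ≤
      Y * (y ^ k / k.factorial) := by
    have := hterm k le_rfl
    rwa [← hk, div_self (by positivity), mul_one, hk] at this
  have htot : ‖G m x‖ ≤ Y * ∑ i ∈ Finset.range (k + 1), y ^ i / i.factorial := by
    rw [Finset.sum_range_succ, mul_add, Finset.mul_sum]
    have := norm_sub_norm_le (G m x) (∑ i ∈ Finset.range k, monomial i (x - a) * G (m + i) a)
    linarith
  have hexp : ∑ i ∈ Finset.range (k + 1), y ^ i / i.factorial ≤ E :=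
    (Real.sum_le_exp_of_nonneg hy0 _).trans (Real.exp_le_exp.2 hy1)
  calc ‖G m x‖ ≤ Y * E := htot.trans (by gcongr)
    _ = _ := by rw [hY, pow_succ]; field_simp

/-- Smallness of level A + d at 0 is spent one factor e at a time, on steps of lengths 1/(e h q_l)
with l descending from A + d - 1 to A, where q_l = `step r N l`. -/
theorem IsTower.bang (hN : IsLC N) (hK : 0 ≤ K) (hh : 0 < h) {b : ℝ} (A d : ℕ)
    (hG : IsTower G (Icc 0 b)) (hb : ∀ m, ∀ x ∈ Icc 0 b, ‖G m x‖ ≤ K * h ^ m * interp r N m)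
    (ha : ∀ m, ‖G m 0‖ ≤ K * h ^ m * interp r N m * (Real.exp 1 ^ m / Real.exp 1 ^ (A + d)))
    {x : ℝ} (hx : x ∈ Icc 0 b)
    (hxd : x ≤ ∑ l ∈ Finset.range d, 1 / (Real.exp 1 * h * step r N (A + l))) (m : ℕ) :
    ‖G m x‖ ≤ K * h ^ m * interp r N m * (Real.exp 1 ^ m / Real.exp 1 ^ A) := by
  induction d generalizing A x m with
  | zero =>
    obtain rfl : x = 0 := le_antisymm (by simpa using hxd) hx.1
    exact ha m
  | succ d ih =>
    rw [Finset.sum_range_succ'] at hxd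
    set S := ∑ l ∈ Finset.range d, 1 / (Real.exp 1 * h * step r N (A + (l + 1))) with hS
    have hpos : ∀ l, 0 < 1 / (Real.exp 1 * h * step r N l) := fun l => by
      have := step_pos (r := r) hN l; positivity
    have hS0 : 0 ≤ S := Finset.sum_nonneg fun l _ => (hpos _).le
    have e : ∀ l, A + (l + 1) = A + 1 + l := fun l => by ring
    have hih : ∀ y ∈ Icc 0 b, y ≤ S → ∀ m, ‖G m y‖ ≤
        K * h ^ m * interp r N m * (Real.exp 1 ^ m / Real.exp 1 ^ (A + 1)) := by
      intro y hy hyS m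
      refine ih (A + 1) (fun m => by rw [← e d]; exact ha m) hy ?_ m
      exact hyS.trans_eq (Finset.sum_congr rfl fun l _ => by rw [e l])
    rcases le_total x S with hxS | hxS
    · refine (hih x hx hxS m).trans ?_
      have := interp_pos (r := r) hN m
      gcongr
      · exact Real.one_le_exp zero_le_one
      · omega
    · have hsub : Icc S x ⊆ Icc 0 b := Icc_subset_Icc hS0 hx.2
      refine IsTower.bang_step hN hK hh (hG.mono hsub) (fun m y hy => hb m y (hsub hy))
        (hih S (hsub ⟨le_rfl, hxS⟩) le_rfl) ?_ m ⟨hxS, le_rfl⟩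
      simp only [add_zero] at hxd
      linarith

end Bang

/-! ### Necessity: the quantitative argument -/

/-- The jet with the single nonzero entry `T` at `r * p` is approximated, entrywise, by jets at `0`
of functions on `[0, 1]` that satisfy the bounds of the class with constants `K` and `h`. -/
def ApproxJet (r : ℕ) (N : ℕ → ℝ) (K h T : ℝ) (p : ℕ) : Prop :=
  ∀ (Q : ℕ) (η : ℝ), 0 < η → ∃ G : ℕ → ℝ → ℂ, IsTower G (Icc 0 1) ∧
    (∀ n, ∀ x ∈ Icc (0 : ℝ) 1, ‖G (r * n) x‖ ≤ K * h ^ n * N n) ∧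
    ∀ m < r * Q, ‖G m 0 - (if m = r * p then (T : ℂ) else 0)‖ ≤ η

section Necessity

variable {r : ℕ} {M N : ℕ → ℝ}

lemma IsTower.sub_monomial {G : ℕ → ℝ → ℂ} {s : Set ℝ} (hG : IsTower G s) (T : ℂ) (k : ℕ) :
    IsTower (fun m x => G m x - T * monomialDeriv k m x) s := fun m x hx =>
  (hG m x hx).sub ((hasDerivAt_monomialDeriv k m x).const_mul T).hasDerivWithinAt

/-- Let τ be the largest distance up to which all derivatives of order below rp of T x^{rp}/(rp)!
stay within 4 K₁ h^m P_m, where P = `interp r N`. The claim is that the partial sum is at most τ;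
otherwise Bang's estimate would make the monomial too close to an approximant at τ. -/
theorem ApproxJet.sum_pow_mul_le (hr : 1 ≤ r) (hN : IsLC N) {K h T K₁ : ℝ} {p : ℕ}
    (hp : 1 ≤ p) (hh : 1 ≤ h) (hK₁ : 0 < K₁)
    (hint : ∀ G : ℕ → ℝ → ℂ, IsTower G (Icc 0 1) →
      (∀ n, ∀ x ∈ Icc (0 : ℝ) 1, ‖G (r * n) x‖ ≤ K * h ^ n * N n) →
      ∀ m, ∀ x ∈ Icc (0 : ℝ) 1, ‖G m x‖ ≤ K₁ * h ^ m * interp r N m)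
    (hT : 4 * K₁ * (r * p).factorial ≤ T) (happ : ApproxJet r N K h T p) (d : ℕ) {m : ℕ}
    (hm : m < r * p) :
    (∑ l ∈ Finset.range d, 1 / (Real.exp 1 * h * step r N (r * p + l))) ^ (r * p - m) * T ≤
      4 * K₁ * h ^ m * interp r N m * (r * p - m).factorial := by
  have hT0 : 0 < T := lt_of_lt_of_le (by positivity) hT
  have hP : ∀ m, 1 ≤ interp r N m := one_le_interp hN
  have hP0 : ∀ m, 0 < interp r N m := interp_pos hN
  have hh0 : 0 < h := by linarith
  set E := Real.exp 1 with hE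
  have hE2 : 2 ≤ E := by have := Real.add_one_le_exp 1; rw [hE]; linarith
  set S := ∑ l ∈ Finset.range d, 1 / (E * h * step r N (r * p + l)) with hS
  have hS0 : 0 ≤ S := Finset.sum_nonneg fun l _ => by
    have := step_pos (r := r) hN (r * p + l); positivity
  let Z : ℕ → ℝ := fun m => 4 * K₁ * h ^ m * interp r N m * (r * p - m).factorial / T
  have hZ0 : ∀ m, 0 < Z m := fun m => by have := hP0 m; positivity
  let Y : ℕ → ℝ := fun m => Z m ^ (1 / ((r * p - m : ℕ) : ℝ))
  have hY0 : ∀ m, 0 < Y m := fun m => Real.rpow_pos_of_pos (hZ0 m) _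
  have hYZ : ∀ m < r * p, Y m ^ (r * p - m) = Z m := fun m hm =>
    rpow_one_div_pow (hZ0 m).le (by omega)
  have hrp : 0 < r * p := Nat.mul_pos hr hp
  -- Y m is the point where the m-th derivative of the monomial reaches its bound, and k is the
  -- order for which this happens first. The hypothesis on T, used at m = 0, keeps that point in
  -- [0,1].
  obtain ⟨k, hk, hmin⟩ := Finset.exists_min_image (Finset.range (r * p)) Y
    ⟨0, Finset.mem_range.2 hrp⟩
  rw [Finset.mem_range] at hk
  set τ := Y k with hτ
  have hτ0 : 0 < τ := hY0 k
  have hτle : ∀ m < r * p, τ ^ (r * p - m) ≤ Z m := fun m hm => by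
    rw [← hYZ m hm]
    exact pow_le_pow_left₀ hτ0.le (hmin m (Finset.mem_range.2 hm)) _
  have hτ1 : τ ≤ 1 := by
    have h1 := hτle 0 hrp
    have h2 : Z 0 ≤ 1 := by
      simp only [Z]
      rw [div_le_one hT0]
      simpa [interp] using hT
    exact (pow_le_one_iff_of_nonneg hτ0.le (by omega)).1 (h1.trans h2)
  have hSτ : S ≤ τ := by
    by_contra! hlt
    -- The error is the flatness Bang's estimate needs at level rp + d. Orders m ≥ r(p+d+1) need no
    -- approximation, since there the weight e^{m-(rp+d)} is at least 1.
    obtain ⟨G, hG, hGb, hG0⟩ := happ (p + d + 1) (K₁ / E ^ (r * p + d)) (by positivity)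
    have hGi := hint G hG hGb
    have hη1 : K₁ / E ^ (r * p + d) ≤ K₁ := div_le_self hK₁.le (one_le_pow₀ (by linarith))
    have hhP : ∀ m, 1 ≤ h ^ m * interp r N m := fun m =>
      one_le_mul_of_one_le_of_one_le (one_le_pow₀ hh) (hP m)
    have hsub : Icc 0 τ ⊆ Icc (0 : ℝ) 1 := Icc_subset_Icc le_rfl hτ1
    have hTb : T ≤ 2 * (K₁ * h ^ (r * p) * interp r N (r * p)) := by
      have h1 := hG0 (r * p) (by rw [Nat.mul_lt_mul_left (by omega)]; omega)
      rw [if_pos rfl, norm_sub_rev] at h1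
      have h2 := norm_sub_norm_le (T : ℂ) (G (r * p) 0)
      have h3 := hGi (r * p) 0 ⟨le_rfl, zero_le_one⟩
      rw [Complex.norm_real, Real.norm_of_nonneg hT0.le] at h2
      have h4 : K₁ ≤ K₁ * h ^ (r * p) * interp r N (r * p) := by
        rw [mul_assoc]; exact le_mul_of_one_le_right hK₁.le (hhP _)
      linarith
    have hmono : ∀ m, ∀ x ∈ Icc (0 : ℝ) τ, ‖(T : ℂ) * monomialDeriv (r * p) m x‖ ≤
        4 * (K₁ * h ^ m * interp r N m) := by
      intro m x hx
      have hnn : 0 ≤ K₁ * h ^ m * interp r N m := by have := hP0 m; positivity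
      rw [norm_mul, Complex.norm_real, Real.norm_of_nonneg hT0.le, monomialDeriv]
      rcases lt_trichotomy m (r * p) with h1 | rfl | h1
      · rw [if_pos h1.le, norm_monomial, abs_of_nonneg hx.1]
        have h2 : x ^ (r * p - m) ≤ Z m :=
          (pow_le_pow_left₀ hx.1 hx.2 _).trans (hτle m h1)
        simp only [Z] at h2
        rw [le_div_iff₀ hT0] at h2
        rw [← mul_div_assoc, div_le_iff₀ (by positivity)]
        linarith
      · rw [if_pos le_rfl, norm_monomial]
        simp only [Nat.sub_self, pow_zero, Nat.factorial_zero, Nat.cast_one, div_one, mul_one]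
        linarith
      · rw [if_neg (by omega), norm_zero, mul_zero]
        positivity
    have hHb : ∀ m, ∀ x ∈ Icc (0 : ℝ) τ, ‖G m x - (T : ℂ) * monomialDeriv (r * p) m x‖ ≤
        (5 * K₁) * h ^ m * interp r N m := by
      intro m x hx
      have h1 := hmono m x hx
      have h2 := hGi m x (hsub hx)
      have h3 := norm_sub_le (G m x) ((T : ℂ) * monomialDeriv (r * p) m x)
      linarith
    have hH0 : ∀ m, ‖G m 0 - (T : ℂ) * monomialDeriv (r * p) m 0‖ ≤
        (5 * K₁) * h ^ m * interp r N m * (E ^ m / E ^ (r * p + d)) := by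
      intro m
      rcases lt_or_ge m (r * (p + d + 1)) with h1 | h1
      · have h2 := hG0 m h1
        have e : (T : ℂ) * monomialDeriv (r * p) m 0 = if m = r * p then (T : ℂ) else 0 := by
          rw [monomialDeriv_zero_right]; split_ifs <;> simp
        rw [e]
        refine h2.trans ?_
        have hEm : 1 ≤ E ^ m := one_le_pow₀ (by linarith)
        calc K₁ / E ^ (r * p + d) = K₁ * 1 * (1 / E ^ (r * p + d)) := by ring
          _ ≤ (5 * K₁) * (h ^ m * interp r N m) * (E ^ m / E ^ (r * p + d)) := by
              gcongr
              · have := hP0 m; positivity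
              · linarith
              · exact hhP m
          _ = _ := by ring
      · refine (hHb m 0 ⟨le_rfl, hτ0.le⟩).trans (le_mul_of_one_le_right ?_ ?_)
        · have := hP0 m; positivity
        · rw [one_le_div (by positivity)]
          refine pow_le_pow_right₀ (by linarith) (le_trans ?_ h1)
          have := Nat.le_mul_of_pos_left (d + 1) hr
          rw [add_assoc, Nat.mul_add]
          omega
    -- In units of K₁ h^k P_k, with P = `interp r N`, the k-th derivative at τ is 4 for the monomial
    -- and at most 1 for G, so their difference is at least 3. Bang's estimate gives at most 5
    -- e^{k-rp} ≤ 5/2.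
    have hB := IsTower.bang (r := r) hN (by positivity) hh0 (r * p) d
      ((hG.mono hsub).sub_monomial (T : ℂ) (r * p)) hHb hH0 ⟨hτ0.le, le_rfl⟩ hlt.le k
    have h1 := hGi k τ (hsub ⟨hτ0.le, le_rfl⟩)
    have h2 : ‖(T : ℂ) * monomialDeriv (r * p) k τ‖ = 4 * (K₁ * h ^ k * interp r N k) := by
      rw [norm_mul, Complex.norm_real, Real.norm_of_nonneg hT0.le, monomialDeriv, if_pos hk.le,
        norm_monomial, abs_of_nonneg hτ0.le, hτ, hYZ k hk]
      simp only [Z]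
      field_simp
    have h3 := norm_sub_norm_le ((T : ℂ) * monomialDeriv (r * p) k τ) (G k τ)
    rw [norm_sub_rev] at h3
    have hpos : 0 < K₁ * h ^ k * interp r N k := by have := hP0 k; positivity
    have h4 : E ^ k / E ^ (r * p) ≤ 1 / 2 := by
      rw [div_le_iff₀ (by positivity)]
      have h5 : E ^ (k + 1) ≤ E ^ (r * p) := pow_le_pow_right₀ (by linarith) hk
      have h6 : E ^ k * 2 ≤ E ^ (k + 1) := by rw [pow_succ]; gcongr
      linarith
    have h7 : (5 * K₁) * h ^ k * interp r N k * (E ^ k / E ^ (r * p)) ≤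
        (5 * K₁) * h ^ k * interp r N k * (1 / 2) := by
      have := hP0 k
      gcongr
    linarith
  have h1 := (pow_le_pow_left₀ hS0 hSτ (r * p - m)).trans (hτle m hm)
  simp only [Z] at h1
  rwa [le_div_iff₀ hT0] at h1

/-- The orders m = rj give M_p ≤ s^p N_j (rp/S)^{r(p-j)} for all j < p, that is λ_{p,s} ≤ (rp/S)^r,
for every partial sum S. Convergence of the series is a by-product. -/
theorem SV_of_approxJet (hr : 1 ≤ r) (hM : IsLC M) (hN : IsLC N) (hMN : Preceq M N)
    {K h ε : ℝ} {T : ℕ → ℝ} (hK : 1 ≤ K) (hh : 1 ≤ h) (hε : 0 < ε)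
    (happ : ∀ᶠ p in atTop, ApproxJet r N K h (T p) p) (hT : ∀ᶠ p in atTop, ε ^ p * M p ≤ T p)
    (hTf : ∀ κ : ℝ, ∀ᶠ p in atTop, κ * (r * p).factorial ≤ T p) : SV r M N := by
  obtain ⟨L, hL, hLb⟩ := exists_intermediate_bound hr hN
  obtain ⟨C₁, C₂, hC₁, hC₂, hle⟩ := hMN
  set K₁ := L * (1 + h) * K with hK₁
  have hK₁1 : 1 ≤ K₁ := by
    have : 1 ≤ L * (1 + h) := by nlinarith
    rw [hK₁]; nlinarith
  set E := Real.exp 1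
  have hE0 : 0 < E := Real.exp_pos 1
  obtain ⟨s, hs⟩ := exists_nat_ge (max C₂ (4 * K₁ * h ^ r / ε))
  have hsC : C₂ ≤ s := (le_max_left _ _).trans hs
  have hsK : 4 * K₁ * h ^ r / ε ≤ s := (le_max_right _ _).trans hs
  have hs1 : 1 ≤ s := by exact_mod_cast hC₂.trans hsC
  let u : ℕ → ℕ → ℝ := fun p k => (1 / quot N (p + k)) ^ (1 / (r : ℝ))
  have hu0 : ∀ p k, 0 ≤ u p k := fun p k =>
    Real.rpow_nonneg (one_div_nonneg.2 (hN.quot_pos _).le) _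
  have hlam : ∀ p, 1 ≤ p → 0 < lam M N p s ^ (1 / (r : ℝ)) := fun p hp =>
    Real.rpow_pos_of_pos (lam_pos hM hN hs1 hp) _
  have hmain : ∀ᶠ p in atTop, ∀ n, ∑ k ∈ Finset.range n, u (p + 1) k ≤
      E * h * p / lam M N p s ^ (1 / (r : ℝ)) := by
    filter_upwards [happ, hT, hTf (4 * K₁), eventually_ge_atTop 1] with p h1 h2 h3 hp n
    have hp0 : (0 : ℝ) < p := by exact_mod_cast hp
    have hr0 : (0 : ℝ) < r := by exact_mod_cast hr
    set S := ∑ l ∈ Finset.range (r * n), 1 / (E * h * step r N (r * p + l)) with hS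
    have hSu : S = r / (E * h) * ∑ k ∈ Finset.range n, u (p + 1) k := by
      have e : ∀ l, 1 / (E * h * step r N (r * p + l)) = 1 / (E * h) * u (p + 1) (l / r) := by
        intro l
        rw [one_div_mul_eq_div, ← one_div_mul_one_div, one_div (step r N _),
          inv_step_mul_add hr hN]
        simp only [u]
        rw [one_div_mul_eq_div, show p + l / r + 1 = p + 1 + l / r by ring]
      rw [hS, Finset.sum_congr rfl fun l _ => e l, ← Finset.mul_sum, sum_range_mul_div hr]
      ring
    rcases (show 0 ≤ S by
      rw [hSu]
      exact mul_nonneg (by positivity) (Finset.sum_nonneg fun k _ => hu0 _ _)).eq_or_lt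
      with hS0 | hS0
    · have : ∑ k ∈ Finset.range n, u (p + 1) k = 0 := by
        rw [hSu] at hS0
        have : (r : ℝ) / (E * h) ≠ 0 := by positivity
        exact (mul_eq_zero.1 hS0.symm).resolve_left this
      rw [this]
      have := hlam p hp
      positivity
    have hlamle : lam M N p s ≤ (r * p / S) ^ r := by
      refine lam_le hM hN hs1 hp (by positivity) fun j hj => ?_
      have hjp : r * j < r * p := by rw [Nat.mul_lt_mul_left (by omega)]; exact hj
      have h4 := h1.sum_pow_mul_le hr hN hp hh (by linarith) (fun G hG hGb => hLb G K h hh hG hGb)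
        h3 (r * n) hjp
      rw [interp_mul hr hN, ← hS] at h4
      have hMp := hM.pos p
      have hNj := hN.pos j
      have h5 : ((r * p - r * j).factorial : ℝ) ≤ (r * p : ℝ) ^ (r * p - r * j) := by
        have : (r * p - r * j).factorial ≤ (r * p) ^ (r * p - r * j) :=
          (Nat.factorial_le_pow _).trans (Nat.pow_le_pow_left (Nat.sub_le _ _) _)
        exact_mod_cast this
      have h6 : 4 * K₁ * h ^ (r * j) ≤ (4 * K₁ * h ^ r) ^ p := by
        rw [mul_pow, ← pow_mul]
        gcongr
        · exact le_self_pow₀ (by linarith) (by omega)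
      have h7 : (4 * K₁ * h ^ r) ^ p ≤ ε ^ p * (s : ℝ) ^ p := by
        rw [← mul_pow]
        refine pow_le_pow_left₀ (by positivity) ?_ p
        rw [div_le_iff₀ hε] at hsK
        linarith
      have h8 : S ^ (r * p - r * j) * (ε ^ p * M p) ≤
          ε ^ p * (s : ℝ) ^ p * N j * (r * p : ℝ) ^ (r * p - r * j) := by
        calc S ^ (r * p - r * j) * (ε ^ p * M p) ≤ S ^ (r * p - r * j) * T p := by gcongr
          _ ≤ _ := h4
          _ ≤ ε ^ p * (s : ℝ) ^ p * N j * (r * p : ℝ) ^ (r * p - r * j) := by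
              have := h6.trans h7
              gcongr
      rw [← pow_mul, Nat.mul_sub, div_pow, ← mul_div_assoc, le_div_iff₀ (by positivity)]
      have hεp : 0 < ε ^ p := by positivity
      refine le_of_mul_le_mul_left ?_ hεp
      linarith
    have h9 : lam M N p s ^ (1 / (r : ℝ)) ≤ r * p / S := by
      refine le_of_pow_le_pow_left₀ (n := r) (by omega) (by positivity) ?_
      rwa [rpow_one_div_pow (lam_pos hM hN hs1 hp).le hr]
    rw [le_div_iff₀ hS0, hSu] at h9
    rw [le_div_iff₀ (hlam p hp)]
    have h10 : lam M N p s ^ (1 / (r : ℝ)) * (r / (E * h) * ∑ k ∈ Finset.range n, u (p + 1) k) =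
      r * (lam M N p s ^ (1 / (r : ℝ)) * ∑ k ∈ Finset.range n, u (p + 1) k) / (E * h) := by ring
    rw [h10, div_le_iff₀ (by positivity), mul_assoc (r : ℝ) p] at h9
    have := le_of_mul_le_mul_left h9 hr0
    linarith
  have hshift : ∀ p q k, u p (k + q) = u (p + q) k := fun p q k => by
    simp only [u]
    rw [show p + (k + q) = p + q + k by ring]
  have hsum : ∀ p, Summable (u p) := by
    obtain ⟨P, hP⟩ := hmain.exists
    have h1 : Summable (u (P + 1)) := summable_of_sum_range_le (hu0 _) hP
    have h0 : Summable (u 0) := by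
      rw [← summable_nat_add_iff (P + 1)]
      simpa only [hshift, zero_add] using h1
    intro p
    have := (summable_nat_add_iff p).2 h0
    simpa only [hshift, zero_add] using this
  let F : ℕ → ℝ := fun p => lam M N p s ^ (1 / (r : ℝ)) / p * ∑' k, u p k
  have hF : BddAbove (range F) := by
    refine IsBoundedUnder.bddAbove_range ⟨C₁ + E * h, ?_⟩
    rw [eventually_map]
    filter_upwards [hmain, eventually_ge_atTop 1] with p h1 hp
    have hp1 : (1 : ℝ) ≤ p := by exact_mod_cast hp
    have h2 : ∑' k, u (p + 1) k ≤ E * h * p / lam M N p s ^ (1 / (r : ℝ)) :=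
      Real.tsum_le_of_sum_range_le (hu0 _) h1
    -- Order rp in `interp` corresponds to index p + 1 of the quotients, so the term k = p is
    -- missing from the sums above; it is handled by λ ≤ C₁ ν_p.
    have h3 : ∑' k, u p k = u p 0 + ∑' k, u (p + 1) k := by
      rw [(hsum p).tsum_eq_zero_add]
      simp only [hshift]
    have h4 : lam M N p s ^ (1 / (r : ℝ)) * u p 0 ≤ C₁ := by
      simp only [u, add_zero]
      rw [← Real.mul_rpow (lam_pos hM hN hs1 hp).le (one_div_nonneg.2 (hN.quot_pos _).le)]
      have h5 : lam M N p s * (1 / quot N p) ≤ C₁ := by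
        rw [mul_one_div, div_le_iff₀ (hN.quot_pos p)]
        exact lam_le_mul_quot hM hN hs1 hp hC₁ hC₂ hsC hle
      refine (Real.rpow_le_rpow (mul_nonneg (lam_pos hM hN hs1 hp).le
        (one_div_nonneg.2 (hN.quot_pos _).le)) h5 (by positivity)).trans ?_
      calc C₁ ^ (1 / (r : ℝ)) ≤ C₁ ^ (1 : ℝ) := by
            refine Real.rpow_le_rpow_of_exponent_le hC₁ ?_
            exact div_le_one_of_le₀ (by exact_mod_cast hr) (Nat.cast_nonneg _)
        _ = C₁ := Real.rpow_one _
    rw [le_div_iff₀ (hlam p hp)] at h2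
    simp only [F]
    rw [h3, div_mul_eq_mul_div, div_le_iff₀ (by linarith), mul_add]
    nlinarith
  obtain ⟨C, hC⟩ := hF
  exact ⟨s, hs1, C, fun p _ => ⟨hsum p, hC (mem_range_self p)⟩⟩

end Necessity

/-! ### Necessity: uniform bounds from Baire's theorem -/

section Baire

variable {r : ℕ} {N : ℕ → ℝ}

/-- The derivative tower `G` realizes the jet `a` at `0`, with the bounds given by `K` and `h`. -/
structure Realizes (r : ℕ) (N : ℕ → ℝ) (K h : ℝ) (a : ℕ → ℂ) (G : ℕ → ℝ → ℂ) : Prop where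
  tower : IsTower G (Icc 0 1)
  bound : ∀ n, ∀ x ∈ Icc (0 : ℝ) 1, ‖G (r * n) x‖ ≤ K * h ^ n * N n
  jet : ∀ n, G (r * n) 0 = a n
  jet_zero : ∀ n j, 1 ≤ j → j < r → G (r * n + j) 0 = 0

lemma ApproxJet.scale {K h T c : ℝ} {p : ℕ} (hc : 0 < c) (H : ApproxJet r N K h T p) :
    ApproxJet r N (c * K) h (c * T) p := by
  intro Q η hη
  obtain ⟨G, h1, h2, h3⟩ := H Q (η / c) (by positivity)
  have hn : ∀ z : ℂ, ‖(c : ℂ) * z‖ = c * ‖z‖ := fun z => by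
    rw [norm_mul, Complex.norm_real, Real.norm_of_nonneg hc.le]
  refine ⟨fun m x => c * G m x, fun m x hx => (h1 m x hx).const_mul _, fun n x hx => ?_,
    fun m hm => ?_⟩
  · rw [hn]
    have := mul_le_mul_of_nonneg_left (h2 n x hx) hc.le
    linarith
  · have h4 := h3 m hm
    rw [le_div_iff₀ hc, mul_comm, ← hn, mul_sub] at h4
    have e : (c : ℂ) * (if m = r * p then (T : ℂ) else 0) =
        if m = r * p then ((c * T : ℝ) : ℂ) else 0 := by
      split_ifs <;> simp
    rwa [e] at h4

lemma ApproxJet.mono (hN : IsLC N) {K K' h T : ℝ} {p : ℕ} (hh : 0 ≤ h) (hK : K ≤ K')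
    (H : ApproxJet r N K h T p) : ApproxJet r N K' h T p := by
  intro Q η hη
  obtain ⟨G, h1, h2, h3⟩ := H Q η hη
  refine ⟨G, h1, fun n x hx => (h2 n x hx).trans ?_, h3⟩
  have := hN.pos n
  gcongr

/-- A product of closed discs is a Baire space, so the jets realized with some fixed constants are
dense in an open set. This set restricts finitely many coordinates only. Working with closures is
why `ApproxJet` allows an error, and no limit of functions is needed. -/
theorem exists_approxJet_of_realizes (hr : 1 ≤ r) {β H : ℕ → ℝ} (hβ : ∀ p, 0 ≤ β p)
    (hcov : ∀ a : ℕ → ℂ, (∀ p, ‖a p‖ ≤ β p) → ∃ k : ℕ, ∃ G, Realizes r N (k + 1) (H k) a G) :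
    ∃ k : ℕ, ∀ᶠ p in atTop, ApproxJet r N (2 * (k + 1)) (H k) (β p) p := by
  let X := ∀ p, Metric.closedBall (0 : ℂ) (β p)
  have hne : Nonempty X := ⟨fun p => ⟨0, by simpa using hβ p⟩⟩
  let S : ℕ → Set X := fun k => {a | ∃ G, Realizes r N (k + 1) (H k) (fun p => (a p : ℂ)) G}
  have hcover : ⋃ k, closure (S k) = univ := by
    refine eq_univ_of_forall fun a => mem_iUnion.2 ?_
    obtain ⟨k, G, hG⟩ := hcov (fun p => a p) fun p => mem_closedBall_zero_iff.1 (a p).2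
    exact ⟨k, subset_closure ⟨G, hG⟩⟩
  obtain ⟨k, a₀, ha₀⟩ := nonempty_interior_of_iUnion_of_closed (fun _ => isClosed_closure) hcover
  obtain ⟨I, U, hU, hsub⟩ := isOpen_pi_iff.1 isOpen_interior a₀ ha₀
  have happrox : ∀ b : X, (∀ i ∈ I, b i = a₀ i) → ∀ (Q : ℕ) (η : ℝ), 0 < η →
      ∃ a : X, (∀ j < Q, ‖(a j : ℂ) - b j‖ ≤ η) ∧
        ∃ G, Realizes r N (k + 1) (H k) (fun p => (a p : ℂ)) G := by
    intro b hb Q η hη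
    have hbcl : b ∈ closure (S k) := interior_subset (hsub fun i hi => by
      rw [hb i hi]; exact (hU i hi).2)
    obtain ⟨a, ha1, ha2⟩ := mem_closure_iff_nhds.1 hbcl
      ((Iio Q).pi fun j => Metric.ball (b j) η)
      (set_pi_mem_nhds (finite_Iio Q) fun j _ => Metric.ball_mem_nhds _ hη)
    refine ⟨a, fun j hj => ?_, ha2⟩
    have := ha1 j hj
    rw [Metric.mem_ball, Subtype.dist_eq, dist_eq_norm] at this
    exact this.le
  refine ⟨k, ?_⟩
  filter_upwards [eventually_gt_atTop (I.sup id)] with p hp Q η hη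
  have hpI : ∀ i ∈ I, i ≠ p := fun i hi h => by
    have : i ≤ I.sup id := Finset.le_sup (f := id) hi
    omega
  -- The p-th coordinate is unrestricted, so it may be set to 0 and to β p; subtracting approximants
  -- of the two points isolates the single entry and doubles the constant.
  let b : X := Function.update a₀ p ⟨0, by simpa using hβ p⟩
  let b' : X := Function.update a₀ p ⟨(β p : ℂ), by simp [abs_of_nonneg (hβ p)]⟩
  obtain ⟨a, ha, G, hG⟩ := happrox b (fun i hi => Function.update_of_ne (hpI i hi) _ _) Q (η / 2)
    (half_pos hη)
  obtain ⟨a', ha', G', hG'⟩ := happrox b' (fun i hi => Function.update_of_ne (hpI i hi) _ _) Q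
    (η / 2) (half_pos hη)
  have hbb : ∀ j, (b' j : ℂ) - b j = if j = p then (β p : ℂ) else 0 := by
    intro j
    by_cases h : j = p
    · subst h; simp [b, b']
    · simp [b, b', h]
  refine ⟨fun m x => G' m x - G m x, fun m x hx => (hG'.tower m x hx).sub (hG.tower m x hx),
    fun n x hx => ?_, fun m hm => ?_⟩
  · have h1 := hG.bound n x hx
    have h2 := hG'.bound n x hx
    have h3 := norm_sub_le (G' (r * n) x) (G (r * n) x)
    linarith
  · obtain ⟨n, j, hj, rfl⟩ : ∃ n j, j < r ∧ m = r * n + j :=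
      ⟨m / r, m % r, Nat.mod_lt _ hr, (Nat.div_add_mod m r).symm⟩
    rcases Nat.eq_zero_or_pos j with rfl | hj0
    · have hn : n < Q := by
        rw [add_zero, Nat.mul_lt_mul_left (by omega)] at hm; exact hm
      have e : (r * n = r * p) ↔ n = p := Nat.mul_right_inj (by omega)
      simp only [e, ← hbb, add_zero, hG.jet, hG'.jet]
      have h1 := ha n hn
      have h2 := ha' n hn
      have h3 := norm_sub_le ((a' n : ℂ) - b' n) (a n - b n)
      have e2 : (a' n : ℂ) - a n - (b' n - b n) = (a' n - b' n) - (a n - b n) := by ring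
      rw [e2]
      linarith
    · have e : r * n + j ≠ r * p := fun h => by
        have := congrArg (· % r) h
        simp [Nat.mod_eq_of_lt hj] at this
        omega
      simp only [hG.jet_zero n j hj0 hj, hG'.jet_zero n j hj0 hj, if_neg e]
      simpa using hη.le

end Baire

/-! ### Restriction maps between the four function spaces -/

section Restrict

variable {t : UltraType} {r : ℕ} {N : ℕ → ℝ} {S T : Set ℝ} {f : ℝ → ℂ}

lemma iteratedDerivWithin_subset (hST : S ⊆ T) (hS : UniqueDiffOn ℝ S) (hT : UniqueDiffOn ℝ T)
    (hf : ContDiffOn ℝ ∞ f T) (m : ℕ) {x : ℝ} (hx : x ∈ S) :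
    iteratedDerivWithin m f S x = iteratedDerivWithin m f T x := by
  rw [iteratedDerivWithin_eq_iteratedFDerivWithin, iteratedDerivWithin_eq_iteratedFDerivWithin,
    iteratedFDerivWithin_subset hST hS hT (hf.of_le (by exact_mod_cast le_top)) hx]

lemma ramClass_subset (h0 : (0 : ℝ) ∈ S) (hST : S ⊆ T) (hS : UniqueDiffOn ℝ S)
    (hT : UniqueDiffOn ℝ T) (hf : f ∈ ramClass t r N T) : f ∈ ramClass t r N S := by
  obtain ⟨h1, h2, h3⟩ := hf
  have e := fun (m : ℕ) (x : ℝ) (hx : x ∈ S) => iteratedDerivWithin_subset hST hS hT h1 m hx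
  refine ⟨h1.mono hST, fun n j hj hjr => by rw [e _ 0 h0]; exact h2 n j hj hjr, ?_⟩
  have key : ∀ h : ℝ, BddAbove (range fun q : ℕ × T =>
      ‖iteratedDerivWithin (r * q.1) f T (q.2 : ℝ)‖ / (h ^ q.1 * N q.1)) →
      BddAbove (range fun q : ℕ × S =>
        ‖iteratedDerivWithin (r * q.1) f S (q.2 : ℝ)‖ / (h ^ q.1 * N q.1)) := by
    rintro h ⟨B, hB⟩
    refine ⟨B, ?_⟩
    rintro _ ⟨⟨n, x⟩, rfl⟩
    simp only [e _ x x.2]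
    exact hB ⟨(n, ⟨x, hST x.2⟩), rfl⟩
  cases t with
  | roumieu =>
    obtain ⟨h, hh, hB⟩ := h3
    exact ⟨h, hh, key h hB⟩
  | beurling => exact fun h hh => key h (h3 h hh)

lemma borelMap_subset (h0 : (0 : ℝ) ∈ S) (hST : S ⊆ T) (hS : UniqueDiffOn ℝ S)
    (hT : UniqueDiffOn ℝ T) (hf : f ∈ ramClass t r N T) : borelMap r S f = borelMap r T f :=
  funext fun _ => iteratedDerivWithin_subset hST hS hT hf.1 _ h0

lemma image_spaceD_subset : borelMap r univ '' spaceD t r N 1 ⊆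
    borelMap r (Ici 0) '' spaceL t r N := by
  rintro _ ⟨f, ⟨hf, hs⟩, rfl⟩
  refine ⟨f, ⟨ramClass_subset self_mem_Ici (subset_univ _) (uniqueDiffOn_Ici 0)
    uniqueDiffOn_univ hf, ?_⟩, borelMap_subset self_mem_Ici (subset_univ _) (uniqueDiffOn_Ici 0)
    uniqueDiffOn_univ hf⟩
  refine closure_minimal (fun x hx => ⟨hx.2, ?_⟩) isClosed_Icc
  exact (hs (subset_closure hx.1)).2

lemma image_spaceL_subset : borelMap r (Ici 0) '' spaceL t r N ⊆
    borelMap r (Ici 0) '' spaceN t r N :=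
  image_mono fun _ hf => hf.1

lemma image_spaceN_subset : borelMap r (Ici 0) '' spaceN t r N ⊆
    borelMap r (Icc 0 1) '' spaceE t r N := by
  rintro _ ⟨f, hf, rfl⟩
  have h0 : (0 : ℝ) ∈ Icc (0 : ℝ) 1 := ⟨le_rfl, zero_le_one⟩
  exact ⟨f, ramClass_subset h0 Icc_subset_Ici_self (uniqueDiffOn_Icc one_pos)
    (uniqueDiffOn_Ici 0) hf, borelMap_subset h0 Icc_subset_Ici_self (uniqueDiffOn_Icc one_pos)
    (uniqueDiffOn_Ici 0) hf⟩

lemma isTower_iteratedDerivWithin (hf : ContDiffOn ℝ ∞ f (Icc 0 1)) :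
    IsTower (fun m => iteratedDerivWithin m f (Icc 0 1)) (Icc 0 1) := fun m x hx => by
  have h := (hf.differentiableOn_iteratedDerivWithin (m := m)
    (by exact_mod_cast ENat.natCast_lt_top m) (uniqueDiffOn_Icc one_pos)) x hx
  simp only [iteratedDerivWithin_succ]
  exact h.hasDerivWithinAt

lemma realizes_of_bound (hN : IsLC N) (hf : f ∈ ramClass t r N (Icc 0 1)) {h : ℝ} (hh : 0 < h)
    {B K H : ℝ} (hB : B ∈ upperBounds (range fun q : ℕ × Icc (0 : ℝ) 1 =>
      ‖iteratedDerivWithin (r * q.1) f (Icc 0 1) (q.2 : ℝ)‖ / (h ^ q.1 * N q.1)))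
    (hK : B ≤ K) (hK0 : 0 ≤ K) (hH : h ≤ H) :
    Realizes r N K H (borelMap r (Icc 0 1) f) fun m => iteratedDerivWithin m f (Icc 0 1) where
  tower := isTower_iteratedDerivWithin hf.1
  bound n x hx := by
    have hNn := hN.pos n
    have h1 : _ ≤ B := hB ⟨(n, ⟨x, hx⟩), rfl⟩
    simp only at h1
    rw [div_le_iff₀ (by positivity)] at h1
    calc _ ≤ B * (h ^ n * N n) := h1
      _ ≤ K * (H ^ n * N n) := by gcongr
      _ = _ := by ring
  jet _ := rfl
  jet_zero := hf.2.1

end Restrict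

/-! ### Necessity in the Roumieu and in the Beurling case -/

section Necessity

variable {t : UltraType} {r : ℕ} {M N : ℕ → ℝ}

lemma factorial_mul_le (hr : 1 ≤ r) (hM : IsLC M) {c : ℝ} (hc : 0 < c) {p : ℕ} (hp : 1 ≤ p)
    (h : c ≤ rootQuot r M p) :
    ((r * p).factorial : ℝ) ≤ ((r * Real.exp 1 / c) ^ r) ^ p * M p := by
  have hMp := hM.pos p
  have hr0 : (0 : ℝ) < r := by exact_mod_cast hr
  have h1 : c ^ p * p.factorial ≤ M p ^ (1 / (r : ℝ)) := by
    rw [← rootQuot_pow hM hp]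
    gcongr
  have h2 : (c ^ p * p.factorial) ^ r ≤ M p := by
    rw [← rpow_one_div_pow (r := r) hMp.le hr]
    exact pow_le_pow_left₀ (by positivity) h1 r
  have h3 : ((r * p).factorial : ℝ) ≤ (r * p : ℝ) ^ (r * p) := by
    exact_mod_cast Nat.factorial_le_pow (r * p)
  have h4 : (r * p : ℝ) ^ p ≤ (r * Real.exp 1) ^ p * p.factorial := by
    rw [mul_pow, mul_pow, mul_assoc]
    exact mul_le_mul_of_nonneg_left (pow_self_le_exp_mul_factorial p) (by positivity)
  calc ((r * p).factorial : ℝ) ≤ ((r * p : ℝ) ^ p) ^ r := by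
        rw [← pow_mul, mul_comm p r]; exact h3
    _ ≤ ((r * Real.exp 1) ^ p * p.factorial) ^ r := by gcongr
    _ = ((r * Real.exp 1 / c) ^ r) ^ p * (c ^ p * p.factorial) ^ r := by
        rw [← pow_mul, mul_comm r p, pow_mul, ← mul_pow, div_pow]
        congr 1
        field_simp
    _ ≤ _ := by gcongr

lemma eventually_mul_factorial_le {a : ℝ} {T : ℕ → ℝ}
    (h : ∀ᶠ p in atTop, ((r * p).factorial : ℝ) ≤ (a / 2) ^ p * M p)
    (hT : ∀ᶠ p in atTop, a ^ p * M p ≤ T p) (κ : ℝ) :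
    ∀ᶠ p in atTop, κ * (r * p).factorial ≤ T p := by
  have h2 : ∀ᶠ p : ℕ in atTop, κ ≤ 2 ^ p :=
    (tendsto_pow_atTop_atTop_of_one_lt (one_lt_two : (1 : ℝ) < 2)).eventually_ge_atTop κ
  filter_upwards [h, hT, h2] with p h1 h3 h4
  calc κ * (r * p).factorial ≤ 2 ^ p * ((a / 2) ^ p * M p) := by gcongr
    _ = a ^ p * M p := by rw [← mul_assoc, ← mul_pow]; congr 2; ring
    _ ≤ T p := h3

theorem SV_of_seqSpace_subset_roumieu (hr : 1 ≤ r) (hM : IsLC M) (hN : IsLC N)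
    (hgrowth : GrowthCondition .roumieu r M) (hMN : Preceq M N)
    (h : seqSpace .roumieu M ⊆ borelMap r (Icc 0 1) '' spaceE .roumieu r N) : SV r M N := by
  obtain ⟨c, hc, hcev⟩ := exists_le_rootQuot hgrowth
  have hr0 : (0 : ℝ) < r := by exact_mod_cast hr
  -- The growth condition yields (rp)! ≤ (a/2)^p M_p; the spare factor 2^p makes a^p M_p beat every
  -- multiple of (rp)!.
  set a := 2 * (r * Real.exp 1 / c) ^ r with ha
  have ha0 : 0 < a := by positivity
  obtain ⟨k, hk⟩ := exists_approxJet_of_realizes (N := N) hr (β := fun p => a ^ p * M p)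
    (H := fun k => k + 1) (fun p => by have := hM.pos p; positivity) fun b hb => by
      obtain ⟨f, hf, hfb⟩ := h (show b ∈ seqSpace .roumieu M from ⟨a, ha0, 1, by
        rintro _ ⟨p, rfl⟩
        have := hM.pos p
        exact div_le_one_of_le₀ (hb p) (by positivity)⟩)
      obtain ⟨h', hh', B, hB⟩ := hf.2.2
      obtain ⟨k, hk⟩ := exists_nat_ge (max h' B)
      have h1 := (le_max_left _ _).trans hk
      have h2 := (le_max_right _ _).trans hk
      rw [← hfb]
      exact ⟨k, _, realizes_of_bound hN hf hh' hB (by linarith) (by positivity) (by linarith)⟩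
  have hT : ∀ᶠ p in atTop, a ^ p * M p ≤ a ^ p * M p := Eventually.of_forall fun _ => le_rfl
  refine SV_of_approxJet hr hM hN hMN (K := 2 * (k + 1)) (h := k + 1)
    (by linarith [(Nat.cast_nonneg k : (0 : ℝ) ≤ k)])
    (by linarith [(Nat.cast_nonneg k : (0 : ℝ) ≤ k)]) ha0 hk hT
    (eventually_mul_factorial_le (a := a) ?_ hT)
  filter_upwards [hcev, eventually_ge_atTop 1] with p h1 hp
  rw [ha, mul_div_cancel_left₀ _ two_ne_zero]
  exact factorial_mul_le hr hM hc hp h1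

/-- No single geometric sequence times M dominates the Beurling space. If all ratios 1/(i+1) failed,
sparse failures would combine into one sequence β whose discs lie in the space, and Baire's theorem
would contradict them. -/
theorem exists_approxJet_beurling (hr : 1 ≤ r) (hM : IsLC M) (hN : IsLC N)
    (h : seqSpace .beurling M ⊆ borelMap r (Icc 0 1) '' spaceE .beurling r N) :
    ∃ i : ℕ, ∀ᶠ p in atTop,
      ApproxJet r N 1 1 (1 / ((i : ℝ) + 1) * ((1 / ((i : ℝ) + 1)) ^ p * M p)) p := by
  by_contra! hcon
  obtain ⟨φ, hφ, hφn⟩ := extraction_forall_of_frequently hcon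
  let β : ℕ → ℝ := Function.extend φ
    (fun i => (1 / ((i : ℝ) + 1)) ^ φ i * M (φ i)) (fun _ => 0)
  have hβφ : ∀ i, β (φ i) = (1 / ((i : ℝ) + 1)) ^ φ i * M (φ i) := fun i =>
    hφ.injective.extend_apply _ _ i
  have hβ0 : ∀ p, (¬ ∃ i, φ i = p) → β p = 0 := fun p hp => Function.extend_apply' _ _ p hp
  have hβnn : ∀ p, 0 ≤ β p := fun p => by
    by_cases hp : ∃ i, φ i = p
    · obtain ⟨i, rfl⟩ := hp
      have := hM.pos (φ i)
      rw [hβφ]; positivity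
    · exact (hβ0 p hp).ge
  obtain ⟨k, hk⟩ := exists_approxJet_of_realizes (N := N) hr (β := β)
    (H := fun _ => 1) hβnn fun b hb => by
      obtain ⟨f, hf, hfb⟩ := h (show b ∈ seqSpace .beurling M from fun y hy => by
        refine IsBoundedUnder.bddAbove_range ⟨1, ?_⟩
        obtain ⟨i₀, hi₀⟩ := exists_nat_one_div_lt hy
        rw [eventually_map]
        filter_upwards [eventually_ge_atTop (φ i₀)] with p hp
        have hMp := hM.pos p
        refine div_le_one_of_le₀ ((hb p).trans ?_) (by positivity)
        by_cases hpi : ∃ i, φ i = p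
        · obtain ⟨i, rfl⟩ := hpi
          have hi : i₀ ≤ i := hφ.le_iff_le.1 hp
          rw [hβφ]
          have h1 : 1 / ((i : ℝ) + 1) ≤ y := by
            refine le_trans ?_ hi₀.le
            exact one_div_le_one_div_of_le (by positivity) (by
              have : (i₀ : ℝ) ≤ i := by exact_mod_cast hi
              linarith)
          gcongr
        · rw [hβ0 p hpi]; positivity)
      obtain ⟨B, hB⟩ := hf.2.2 1 one_pos
      obtain ⟨k, hk⟩ := exists_nat_ge B
      rw [← hfb]
      exact ⟨k, _, realizes_of_bound hN hf one_pos hB (by linarith) (by positivity) le_rfl⟩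
  obtain ⟨P, hP⟩ := eventually_atTop.1 hk
  let i := max P (2 * (k + 1))
  -- Taking i ≥ 2(k+1), the extra factor 1/(i+1) brings the constant from Baire's theorem below 1.
  have h1 := (hP (φ i) ((le_max_left _ _).trans (hφ.id_le i))).scale
    (c := 1 / ((i : ℝ) + 1)) (by positivity)
  rw [hβφ] at h1
  refine absurd ?_ (hφn i)
  refine h1.mono hN zero_le_one ?_
  rw [one_div_mul_eq_div, div_le_one (by positivity)]
  have : ((2 * (k + 1) : ℕ) : ℝ) ≤ i := by exact_mod_cast le_max_right _ _
  push_cast at this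
  linarith

theorem SV_of_seqSpace_subset_beurling (hr : 1 ≤ r) (hM : IsLC M) (hN : IsLC N)
    (hgrowth : GrowthCondition .beurling r M) (hMN : Preceq M N)
    (h : seqSpace .beurling M ⊆ borelMap r (Icc 0 1) '' spaceE .beurling r N) : SV r M N := by
  obtain ⟨i, hi⟩ := exists_approxJet_beurling hr hM hN h
  have hr0 : (0 : ℝ) < r := by exact_mod_cast hr
  set δ := 1 / ((i : ℝ) + 1) with hδ
  have hδ0 : 0 < δ := by positivity
  have hδ1 : δ ≤ 1 := by
    rw [hδ, div_le_one (by positivity)]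
    linarith [(Nat.cast_nonneg i : (0 : ℝ) ≤ i)]
  have hT : ∀ᶠ p in atTop, (δ ^ 2) ^ p * M p ≤ δ * (δ ^ p * M p) := by
    filter_upwards [eventually_ge_atTop 1] with p hp
    have hMp := hM.pos p
    have h1 : (δ ^ 2) ^ p ≤ δ ^ (1 + p) := by
      rw [← pow_mul]
      exact pow_le_pow_of_le_one hδ0.le hδ1 (by omega)
    calc (δ ^ 2) ^ p * M p ≤ δ ^ (1 + p) * M p := by gcongr
      _ = _ := by rw [pow_add]; ring
  refine SV_of_approxJet hr hM hN hMN le_rfl le_rfl (ε := δ ^ 2) (by positivity) hi hT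
    (eventually_mul_factorial_le (a := δ ^ 2) ?_ hT)
  have hlim : Tendsto (fun c : ℝ => (r * Real.exp 1 / c) ^ r) atTop (𝓝 0) := by
    have := (tendsto_const_nhds (x := r * Real.exp 1)).div_atTop (tendsto_id (α := ℝ)
      (x := atTop))
    simpa [show r ≠ 0 by omega] using this.pow r
  -- Here δ is prescribed by Baire's theorem, so (rp)! must be negligible against an arbitrarily
  -- small geometric factor times M_p. The Beurling growth condition supplies this, since c may be
  -- taken as large as needed.
  obtain ⟨c, hc1, hc0⟩ := ((hlim.eventually (gt_mem_nhds (show 0 < δ ^ 2 / 2 by positivity))).and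
    (eventually_gt_atTop 0)).exists
  have hg : Tendsto (rootQuot r M) atTop atTop := hgrowth
  filter_upwards [hg.eventually_ge_atTop c, eventually_ge_atTop 1] with p h1 hp
  refine (factorial_mul_le hr hM hc0 hp h1).trans ?_
  have hMp := hM.pos p
  gcongr

theorem SV_of_seqSpace_subset (hr : 1 ≤ r) (hM : IsLC M) (hN : IsLC N)
    (hgrowth : GrowthCondition t r M) (hMN : Preceq M N)
    (h : seqSpace t M ⊆ borelMap r (Icc 0 1) '' spaceE t r N) : SV r M N := by
  cases t with
  | roumieu => exact SV_of_seqSpace_subset_roumieu hr hM hN hgrowth hMN h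
  | beurling => exact SV_of_seqSpace_subset_beurling hr hM hN hgrowth hMN h

end Necessity

end RamifiedBorel

theorem mainTheorem3 (t : RamifiedBorel.UltraType) (r : ℕ) (hr : 1 ≤ r) (M N : ℕ → ℝ)
    (hM : RamifiedBorel.IsLC M) (hN : RamifiedBorel.IsLC N)
    (hgrowth : RamifiedBorel.GrowthCondition t r M)
    (hMN : RamifiedBorel.Preceq M N) :
    (RamifiedBorel.seqSpace t M ⊆
        RamifiedBorel.borelMap r Set.univ '' RamifiedBorel.spaceD t r N 1 ↔
      RamifiedBorel.SV r M N) ∧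
    (RamifiedBorel.seqSpace t M ⊆
        RamifiedBorel.borelMap r (Set.Ici 0) '' RamifiedBorel.spaceL t r N ↔
      RamifiedBorel.SV r M N) ∧
    (RamifiedBorel.seqSpace t M ⊆
        RamifiedBorel.borelMap r (Set.Ici 0) '' RamifiedBorel.spaceN t r N ↔
      RamifiedBorel.SV r M N) ∧
    (RamifiedBorel.seqSpace t M ⊆
        RamifiedBorel.borelMap r (Set.Icc 0 1) '' RamifiedBorel.spaceE t r N ↔
      RamifiedBorel.SV r M N) := by
  have nec := RamifiedBorel.SV_of_seqSpace_subset (t := t) hr hM hN hgrowth hMN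
  have suf := RamifiedBorel.seqSpace_subset_of_SV hr hM hN hgrowth hMN
  have hDL := RamifiedBorel.image_spaceD_subset (t := t) (r := r) (N := N)
  have hLN := RamifiedBorel.image_spaceL_subset (t := t) (r := r) (N := N)
  have hNE := RamifiedBorel.image_spaceN_subset (t := t) (r := r) (N := N)
  exact ⟨⟨fun h => nec (h.trans (hDL.trans (hLN.trans hNE))), suf⟩,
    ⟨fun h => nec (h.trans (hLN.trans hNE)), fun h => (suf h).trans hDL⟩,
    ⟨fun h => nec (h.trans hNE), fun h => (suf h).trans (hDL.trans hLN)⟩,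
    ⟨nec, fun h => (suf h).trans (hDL.trans (hLN.trans hNE))⟩⟩
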